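/- Setting. Let $z_1,\dots,z_{n-1}\in\mathbb{C}$ be distinct, $z_n=\infty$, $S=\{z_1,\dots,z_n\}\subset\mathbb{CP}^1$, and $\zeta=1/z$. Let $N=\mathrm{diag}(m_1,\dots,m_r)$ with integers $m_1\le\dots\le m_r$, and let $E_N=\bigoplus_j\mathcal{O}(m_j)$ be the bundle on $\mathbb{CP}^1$ with transition function $g_{01}(z)=z^N$. An element of $\mathrm{Aut}(E_N)$ is a pair of holomorphic maps $g_0,g_1:\mathbb{C}\to\mathrm{GL}(r,\mathbb{C})$ with $g_0(z)=z^Ng_1(1/z)z^{-N}$ for $z\ne0$. Let $\mathcal{W}$ be given by weights $0\le\alpha_{i1}<\dots<\alpha_{ir}<1$, put $W_i=\mathrm{diag}(\alpha_{i1},\dots,\alpha_{ir})$ for $i=1,\dots,n$, and let $\mathbf{F}=(F_1,\dots,F_n)$ be complete descending flags in $\mathbb{C}^r$, regarded as flags in the fibers of $E_N$ over $z_1,\dots,z_n$ (in the trivialization over the chart $z$ for $i<n$, over the chart $\zeta$ for $i=n$). A logarithmic connection adapted to $(\mathbf{F},\mathcal{W})$ on $E_N$ is a form $A(z)=\bigl(\sum_{i=1}^{n-1}\frac{A_i}{z-z_i}+f_0(z)\bigr)dz$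 with $f_0$ entire, such that $z^{-N}A(z)z^N+N\,dz/z$ equals $(A_n/\zeta+\text{holomorphic})\,d\zeta$ near $\infty$ and such that for each $i=1,\dots,n$ there is $B_i\in\mathrm{GL}(r,\mathbb{C})$ with $A_i=B_iW_iB_i^{-1}$ whose columns $b_{i1},\dots,b_{ir}$ give $F_i$ (the $j$-th space of $F_i$ is spanned by $b_{ij},\dots,b_{ir}$). Let $\mathcal{A}_{\mathbf{F}}$ be the set of these. The group $\mathrm{Aut}(E_N)$ acts by $g\cdot A=g_0Ag_0^{-1}-dg_0\,g_0^{-1}$ and $g\cdot\mathbf{F}=(g_0(z_1)F_1,\dots,g_0(z_{n-1})F_{n-1},g_1(0)F_n)$. Let $\mathrm{P}_N$ be the group of invertible matrices whose $(j,k)$ entry vanishes whenever $m_j<m_k$, and let $F_{\mathrm{std}}$ be the flag of the standard basis $e_1,\dots,e_r$. Statement. Let $A\in\mathcal{A}_{\mathbf{F}}$. There is a permutation matrix $\Pi_n$ with $F_n\in \mathrm{P}_N\,\Pi_n\cdot F_{\mathrm{std}}$. For every such $\Pi_n$, with $N'=\Pi_n^{-1}N\Pi_n$, there is $g\in\mathrm{Aut}(E_N)$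 such that, near $z_n=\infty$, $$g\cdot A=\left(\frac{\Pi_n(W_n+N')\Pi_n^{-1}}{\zeta}+f_1'(\zeta)\right)d\zeta\qquad(f_1'\text{ holomorphic at }\zeta=0),$$ and for fixed $\Pi_n$ such a $g$ is unique up to left multiplication by a constant invertible diagonal matrix. For every such $g$: 1. $g\cdot A\in\mathcal{A}_{g\cdot\mathbf{F}}$; 2. $g\cdot A$ is a Fuchsian system on $\mathbb{CP}^1$: $g\cdot A=\sum_{i=1}^{n-1}\frac{A_i'}{z-z_i}\,dz$ with constant matrices $A_i'$, and $\sum_{i=1}^{n-1}A_i'=-\Pi_n(W_n+N')\Pi_n^{-1}$; 3. $g\cdot A$ has the same monodromy representation as $A$: for every base point $x_0\in\mathbb{CP}^1\setminus S$, analytic continuation of the fundamental solution of $dY+AY=0$ equal to the identity at $x_0$ defines a representation $\rho:\pi_1(\mathbb{CP}^1\setminus S,x_0)\to\mathrm{GL}(r,\mathbb{C})$, and the monodromy representation of $g\cdot A$ is $g_0(x_0)\,\rho\,g_0(x_0)^{-1}$. Thus $g\cdot A$ (the Riemann–Hilbert gauge) is a representative, in the $\mathrm{Aut}(E_N)$-orbit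 of $A$, that solves the Riemann–Hilbert problem for the monodromy representation of $A$. -/

import Mathlib

open Topology Filter
open scoped MatrixGroups

namespace RHGauge

/-! ### Matrices -/

/-- The space of complex `r × r` matrices. -/
abbrev Mat (r : ℕ) := Matrix (Fin r) (Fin r) ℂ

/-- A matrix-valued function all of whose entries are entire. -/
def IsEntire {r : ℕ} (f : ℂ → Mat r) : Prop :=
  ∀ a b, Differentiable ℂ (fun w => f w a b)

/-- A matrix-valued function all of whose entries are holomorphic near `0`. -/
def IsHolomorphicAtZero {r : ℕ} (f : ℂ → Mat r) : Prop :=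
  ∀ a b, AnalyticAt ℂ (fun w => f w a b) 0

/-- The entrywise complex derivative of a matrix-valued function. -/
noncomputable def matDeriv {r : ℕ} (f : ℂ → Mat r) (w : ℂ) : Mat r :=
  Matrix.of fun a b => deriv (fun u => f u a b) w

/-- The diagonal matrix `N` with integral entries `m`. -/
def splitMat {r : ℕ} (m : Fin r → ℤ) : Mat r := Matrix.diagonal fun j => (m j : ℂ)

/-- The diagonal matrix `w ^ N`, used for `w ≠ 0`. -/
noncomputable def powMat {r : ℕ} (m : Fin r → ℤ) (w : ℂ) : Mat r :=
  Matrix.diagonal fun j => w ^ m j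

/-- The diagonal matrix `W` of a row of weights. -/
def weightMat {r : ℕ} (a : Fin r → ℝ) : Mat r := Matrix.diagonal fun j => (a j : ℂ)

/-- The permutation matrix `Π`, with entries `Π j k = 1` if `k = σ j` and `0` otherwise,
as an element of the general linear group. -/
noncomputable def permGL {r : ℕ} (σ : Equiv.Perm (Fin r)) : GL (Fin r) ℂ where
  val := σ.permMatrix ℂ
  inv := σ⁻¹.permMatrix ℂ
  val_inv := by rw [← Matrix.permMatrix_mul]; simp
  inv_val := by rw [← Matrix.permMatrix_mul]; simp

/-- Conjugation `Ad(g)(X) = g X g⁻¹`. -/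
noncomputable def Ad {r : ℕ} (g : GL (Fin r) ℂ) (X : Mat r) : Mat r :=
  (g : Mat r) * X * ((g⁻¹ : GL (Fin r) ℂ) : Mat r)

/-! ### Complete descending flags -/

/-- A complete descending flag `ℂ^r = V 0 ⊃ V 1 ⊃ ⋯ ⊃ V (r-1) ⊃ {0}`. -/
@[ext] structure CompleteFlag (r : ℕ) where
  V : Fin r → Submodule ℂ (Fin r → ℂ)
  antitone : Antitone V
  finrank_eq : ∀ j, Module.finrank ℂ (V j) = r - j

/-- The flag of an ordered frame: `V j` is spanned by the columns `j, …, r-1` of `B`. -/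
noncomputable def flagOfFrame {r : ℕ} (B : GL (Fin r) ℂ) : CompleteFlag r where
  V j := Submodule.span ℂ ((fun l => (B : Mat r).col l) '' Set.Ici j)
  antitone := fun _ _ h => Submodule.span_mono (Set.image_mono (Set.Ici_subset_Ici.mpr h))
  finrank_eq := by
    intro j
    have hli : LinearIndependent ℂ (B : Mat r).col :=
      Matrix.linearIndependent_cols_of_isUnit B.isUnit
    have h2 : LinearIndependent ℂ (fun l : Set.Ici j => (B : Mat r).col l) :=
      hli.comp _ Subtype.val_injective
    rw [Set.image_eq_range, finrank_span_eq_card h2]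
    simp

/-- The left action of the general linear group on complete flags. -/
noncomputable def CompleteFlag.act {r : ℕ} (g : GL (Fin r) ℂ) (F : CompleteFlag r) :
    CompleteFlag r where
  V j := (F.V j).map (Matrix.mulVecLin (g : Mat r))
  antitone := fun _ _ h => Submodule.map_mono (F.antitone h)
  finrank_eq := by
    intro j
    have hinj : Function.Injective (Matrix.mulVecLin (g : Mat r)) := by
      rw [Matrix.coe_mulVecLin]
      exact Matrix.mulVec_injective_of_isUnit g.isUnit
    rw [← F.finrank_eq j]
    exact (Submodule.equivMapOfInjective _ hinj (F.V j)).finrank_eq.symm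

/-- The standard parabolic group `P_N`: the `(j, k)` entry vanishes if `m j < m k`.  For
nondecreasing `m` these are the block lower triangular matrices, with blocks given by the
multiplicities of the values of `m`. -/
def IsParabolic {r : ℕ} (m : Fin r → ℤ) (p : GL (Fin r) ℂ) : Prop :=
  ∀ j k, m j < m k → (p : Mat r) j k = 0

/-- The flag `F` lies in the `P_N`-orbit `P_N · Π · F_std` of the translate by `Π` of the
standard descending flag. -/
def InCell {r : ℕ} (m : Fin r → ℤ) (σ : Equiv.Perm (Fin r)) (F : CompleteFlag r) : Prop :=
  ∃ p : GL (Fin r) ℂ, IsParabolic m p ∧ F = flagOfFrame (p * permGL σ)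

/-! ### Automorphisms of the split bundle `E_N = 𝒪(m 0) ⊕ ⋯ ⊕ 𝒪(m (r-1))` -/

/-- An automorphism of the bundle over the Riemann sphere with transition function
`g₀₁(z) = z ^ N`: a pair of holomorphic maps on the two affine charts, with coordinates `z` and
`ζ = 1 / z`. -/
structure BundleAut {r : ℕ} (m : Fin r → ℤ) where
  g0 : ℂ → GL (Fin r) ℂ
  g1 : ℂ → GL (Fin r) ℂ
  holo0 : IsEntire fun w => (g0 w : Mat r)
  holo1 : IsEntire fun w => (g1 w : Mat r)
  glue : ∀ w : ℂ, w ≠ 0 →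
    (g0 w : Mat r) = powMat m w * (g1 w⁻¹ : Mat r) * powMat (fun j => -m j) w

/-- The gauge action `g · A = g A g⁻¹ - dg g⁻¹`, in the chart `z`, on the coefficient of a
connection form `A(z) dz`. -/
noncomputable def BundleAut.act {r : ℕ} {m : Fin r → ℤ} (g : BundleAut m) (A : ℂ → Mat r) :
    ℂ → Mat r := fun w =>
  Ad (g.g0 w) (A w) -
    matDeriv (fun u => (g.g0 u : Mat r)) w * (((g.g0 w)⁻¹ : GL (Fin r) ℂ) : Mat r)

/-- The action on tuples of flags in the fibers over `z 0, …, z (k-1)` (in the trivialization over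
the chart `z`) and over `∞` (last index, in the trivialization over the chart `ζ`). -/
noncomputable def BundleAut.actFlags {r k : ℕ} {m : Fin r → ℤ} (g : BundleAut m) (z : Fin k → ℂ)
    (F : Fin (k + 1) → CompleteFlag r) : Fin (k + 1) → CompleteFlag r :=
  Fin.lastCases (motive := fun _ => CompleteFlag r)
    ((F (Fin.last k)).act (g.g1 0)) (fun i => (F i.castSucc).act (g.g0 (z i)))

/-! ### Logarithmic connections -/

/-- The coefficient of `dζ`, `ζ = 1 / z`, in the pullback of the form `A(z) dz` to the chart at
infinity, with no change of frame. -/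
noncomputable def formAtInfty {r : ℕ} (A : ℂ → Mat r) (ζ : ℂ) : Mat r :=
  (-(ζ ^ 2)⁻¹) • A ζ⁻¹

/-- The coefficient of `dζ`, `ζ = 1 / z`, in `z^{-N} A(z) z^N dz + N dz / z`, which is the local
form of the connection in the trivialization over the chart at infinity. -/
noncomputable def connAtInfty {r : ℕ} (m : Fin r → ℤ) (A : ℂ → Mat r) (ζ : ℂ) : Mat r :=
  powMat m ζ * formAtInfty A ζ * powMat (fun j => -m j) ζ - ζ⁻¹ • splitMat m

/-- `A(z) dz` is the local form over `ℂ` of a logarithmic connection on `E_N` with poles at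
`z 0, …, z (k-1)` and `∞`, adapted to the flags `F` and the weights `α` (the last index
belongs to `∞`).  Only the values of `A` off the poles matter. -/
def IsAdaptedConnection {r k : ℕ} (m : Fin r → ℤ) (z : Fin k → ℂ) (α : Fin (k + 1) → Fin r → ℝ)
    (F : Fin (k + 1) → CompleteFlag r) (A : ℂ → Mat r) : Prop :=
  ∃ R : Fin (k + 1) → Mat r,
    (∃ f₀ : ℂ → Mat r, IsEntire f₀ ∧
      ∀ w, w ∉ Set.range z → A w = ∑ i : Fin k, (w - z i)⁻¹ • R i.castSucc + f₀ w) ∧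
    (∃ f₁ : ℂ → Mat r, IsHolomorphicAtZero f₁ ∧
      ∀ᶠ ζ in 𝓝[≠] (0 : ℂ), connAtInfty m A ζ = ζ⁻¹ • R (Fin.last k) + f₁ ζ) ∧
    ∀ i, ∃ B : GL (Fin r) ℂ, R i = Ad B (weightMat (α i)) ∧ F i = flagOfFrame B

/-- The matrix `Ad(Π)(W + N')`, where `N' = Ad(Π⁻¹)(N)`. -/
noncomputable def normalResidue {r : ℕ} (m : Fin r → ℤ) (a : Fin r → ℝ)
    (σ : Equiv.Perm (Fin r)) : Mat r :=
  Ad (permGL σ) (weightMat a + Ad (permGL σ)⁻¹ (splitMat m))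

/-- Over the chart `z`, the form `A(z) dz` expands near infinity as
`(Ad(Π)(W + N') / ζ + f(ζ)) dζ` with `f` holomorphic at `ζ = 0`. -/
def IsNormalizedAtInfty {r : ℕ} (m : Fin r → ℤ) (a : Fin r → ℝ) (σ : Equiv.Perm (Fin r))
    (A : ℂ → Mat r) : Prop :=
  ∃ f : ℂ → Mat r, IsHolomorphicAtZero f ∧
    ∀ᶠ ζ in 𝓝[≠] (0 : ℂ), formAtInfty A ζ = ζ⁻¹ • normalResidue m a σ + f ζ

/-- `d + A(z) dz` is the Fuchsian system on the Riemann sphere with poles in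
`{z 0, …, z (k-1), ∞}` and residues `R i` at the finite poles `z i`. -/
def IsFuchsianSystem {r k : ℕ} (z : Fin k → ℂ) (A : ℂ → Mat r) (R : Fin k → Mat r) : Prop :=
  ∀ w, w ∉ Set.range z → A w = ∑ i, (w - z i)⁻¹ • R i

/-! ### Monodromy -/

/-- The sphere punctured at `z 0, …, z (k-1)` and `∞`. -/
abbrev Punctured {k : ℕ} (z : Fin k → ℂ) := {w : ℂ // w ∉ Set.range z}

/-- `Y` is the analytic continuation along `γ` of a matrix solution of `dY + A Y = 0`: near every
parameter it is the restriction to `γ` of a holomorphic matrix solution on an open set. -/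
def IsContinuation {r k : ℕ} (z : Fin k → ℂ) (A : ℂ → Mat r) {x y : Punctured z} (γ : Path x y)
    (Y : unitInterval → Mat r) : Prop :=
  ∀ t : unitInterval, ∃ Φ : ℂ → Mat r,
    (∀ᶠ w in 𝓝 ((γ t : Punctured z) : ℂ),
      ∀ a b, HasDerivAt (fun u => Φ u a b) (-(A w * Φ w) a b) w) ∧
    ∀ᶠ s in 𝓝 t, Y s = Φ (γ s : Punctured z)

/-- `ρ` is the monodromy representation, based at `x₀`, of the connection `d + A(z) dz`: the class
of a loop is sent to the end value of the continuation along it of the solution that starts at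
the identity.  (In Mathlib's fundamental group, `p * q` is the class of `q` followed by `p`.) -/
def IsMonodromyRep {r k : ℕ} (z : Fin k → ℂ) (A : ℂ → Mat r) (x₀ : Punctured z)
    (ρ : FundamentalGroup (Punctured z) x₀ →* GL (Fin r) ℂ) : Prop :=
  ∀ γ : Path x₀ x₀, ∃ Y : unitInterval → Mat r, IsContinuation z A γ Y ∧ Y 0 = 1 ∧
    Y 1 = (ρ (FundamentalGroup.fromPath (Path.Homotopic.Quotient.mk γ)) : Mat r)

end RHGauge

/-!
In the chart at infinity the connection is a germ `P(ζ) dζ / ζ`. No two eigenvalues of its residue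
differ by an integer, so for eigenvalues `D` the number `n + D i - D j` with `n` an integer and
`i ≠ j` never vanishes.

*Uniqueness.* The transition `h` between two normal forms with residue `D` satisfies, for
`G = ζ ^ n h`, the equation `ζ G' = n G + G D - D G + O(ζ)`. So the leading coefficient of `h` at infinity
can sit only in order zero and commutes with `D`; hence `h` is bounded, is constant by Liouville's
theorem, and is diagonal.

*Existence.* A constant element of the parabolic group moves the flag at infinity to `Π · F_std`,
which makes the residue triangular in the order given by `Π`, with diagonal `d`. The Taylor
coefficients of `ζ ^ e E_ij` that obstruct the normal form are those with `e ≤ m i - m j`, and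
exactly for these the elementary matrix `1 + c ζ ^ e E_ij` extends to an automorphism of the
bundle. Its gauge action changes the coefficient by `-(e + d i - d j) c`, up to terms of larger
weight `e r + σ i - σ j`, so that the obstructions can be removed one at a time in the order of
their weights.

The normalized connection has no polynomial part, again by Liouville's theorem, and the monodromy
is read off the covering of the punctured sphere by the values of local solutions, on which a
gauge transformation acts.
-/

namespace RHGauge

/-! ### Analytic linear differential equations -/

section LinearODE

variable {𝕜 E : Type*} [RCLike 𝕜] [NormedRing E] [NormedAlgebra 𝕜 E]

variable (𝕜) in
/-- The Taylor coefficients at the base point of the solution of `Y' = A Y`, `Y = 1` at the base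
point, in terms of the Taylor coefficients `a` of `A`. -/
noncomputable def solutionCoeff (a : ℕ → E) : ℕ → E
  | 0 => 1
  | n + 1 => ((n : 𝕜) + 1)⁻¹ • ∑ i : Fin (n + 1), a (n - i) * solutionCoeff a i
decreasing_by exact i.isLt

theorem solutionCoeff_zero (a : ℕ → E) : solutionCoeff 𝕜 a 0 = 1 := by rw [solutionCoeff]

theorem succ_smul_solutionCoeff_succ (a : ℕ → E) (n : ℕ) :
    (n + 1) • solutionCoeff 𝕜 a (n + 1) =
      ∑ i ∈ Finset.range (n + 1), a i * solutionCoeff 𝕜 a (n - i) := by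
  have hn : ((n + 1 : ℕ) : 𝕜) ≠ 0 := Nat.cast_ne_zero.2 n.succ_ne_zero
  rw [← Nat.cast_smul_eq_nsmul 𝕜, solutionCoeff, ← Nat.cast_succ, smul_inv_smul₀ hn,
    Fin.sum_univ_eq_sum_range (fun i => a (n - i) * solutionCoeff 𝕜 a i),
    ← Finset.sum_range_reflect]
  refine Finset.sum_congr rfl fun i hi => ?_
  have := Finset.mem_range.1 hi
  congr 2; omega

theorem norm_solutionCoeff_le {a : ℕ → E} {q : ℝ} (ha : ∀ n, ‖a n‖ ≤ q ^ (n + 1)) (n : ℕ) :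
    ‖solutionCoeff 𝕜 a n‖ ≤ ‖(1 : E)‖ * q ^ n := by
  have hq : 0 ≤ q := by simpa using (norm_nonneg _).trans (ha 0)
  induction n using Nat.strong_induction_on with
  | _ n ih =>
    rcases n with _ | n
    · simp [solutionCoeff_zero]
    have hterm : ∀ i ∈ Finset.range (n + 1),
        ‖a i * solutionCoeff 𝕜 a (n - i)‖ ≤ ‖(1 : E)‖ * q ^ (n + 1) := fun i hi => by
      have hin : i ≤ n := Finset.mem_range_succ_iff.1 hi
      calc ‖a i * solutionCoeff 𝕜 a (n - i)‖
          ≤ q ^ (i + 1) * (‖(1 : E)‖ * q ^ (n - i)) :=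
            (norm_mul_le _ _).trans
              (mul_le_mul (ha i) (ih _ (by omega)) (norm_nonneg _) (by positivity))
        _ = ‖(1 : E)‖ * q ^ (n + 1) := by
            rw [mul_left_comm, ← pow_add, show i + 1 + (n - i) = n + 1 by omega]
    have hsum := (norm_sum_le _ _).trans (Finset.sum_le_card_nsmul _ _ _ hterm)
    rw [← succ_smul_solutionCoeff_succ, RCLike.norm_nsmul 𝕜, Finset.card_range, nsmul_eq_mul,
      nsmul_eq_mul] at hsum
    exact le_of_mul_le_mul_left hsum (by positivity)

theorem eventually_hasSum_deriv {F : Type*} [NormedAddCommGroup F] [NormedSpace 𝕜 F]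
    [CompleteSpace F] {f : 𝕜 → F} {p : FormalMultilinearSeries 𝕜 𝕜 F} {c : 𝕜}
    (hp : HasFPowerSeriesAt f p c) :
    ∀ᶠ w in 𝓝 c, HasSum (fun n => (w - c) ^ n • ((n + 1) • p.coeff (n + 1))) (deriv f w) := by
  obtain ⟨R, hR⟩ := hp
  filter_upwards [hasFPowerSeriesAt_iff'.1 hR.fderiv.hasFPowerSeriesAt] with w hw
  simpa [FormalMultilinearSeries.derivSeries_coeff_one] using
    hw.mapL (ContinuousLinearMap.apply 𝕜 F (1 : 𝕜))

theorem eventually_summable_norm {F : Type*} [NormedAddCommGroup F] [NormedSpace 𝕜 F]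
    {f : 𝕜 → F} {p : FormalMultilinearSeries 𝕜 𝕜 F} {c : 𝕜} (hp : HasFPowerSeriesAt f p c) :
    ∀ᶠ w in 𝓝 c, Summable fun n => ‖(w - c) ^ n • p.coeff n‖ := by
  obtain ⟨R, hR⟩ := hp
  filter_upwards [Metric.eball_mem_nhds c (hR.r_pos.trans_le hR.r_le)] with w hw
  have hw0 : w - c ∈ Metric.eball 0 p.radius := by
    simpa [edist_eq_enorm_sub] using hw
  simpa only [FormalMultilinearSeries.apply_eq_pow_smul_coeff] using p.summable_norm_apply hw0

theorem exists_norm_coeff_le_pow_succ {F : Type*} [NormedAddCommGroup F] [NormedSpace 𝕜 F]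
    {p : FormalMultilinearSeries 𝕜 𝕜 F} (hp : 0 < p.radius) :
    ∃ q : ℝ, 0 < q ∧ ∀ n, ‖p.coeff n‖ ≤ q ^ (n + 1) := by
  obtain ⟨C, s, hC, hs, hCs⟩ := p.le_mul_pow_of_radius_pos hp
  refine ⟨max C s, lt_max_of_lt_left hC, fun n => ?_⟩
  calc ‖p.coeff n‖ ≤ C * s ^ n := p.norm_apply_eq_norm_coef (n := n) ▸ hCs n
    _ ≤ max C s * max C s ^ n := by gcongr <;> simp
    _ = max C s ^ (n + 1) := (pow_succ' _ _).symm

theorem exists_hasFPowerSeriesAt [CompleteSpace E] {b : ℕ → E} {K q : ℝ} (hq : 0 < q)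
    (hb : ∀ n, ‖b n‖ ≤ K * q ^ n) (c : 𝕜) :
    ∃ (Y : 𝕜 → E) (s : FormalMultilinearSeries 𝕜 𝕜 E),
      HasFPowerSeriesAt Y s c ∧ ∀ n, s.coeff n = b n := by
  let s : FormalMultilinearSeries 𝕜 𝕜 E := fun n => .mkPiRing 𝕜 (Fin n) (b n)
  have hs : ∀ n, s.coeff n = b n := fun n => by simp [s, FormalMultilinearSeries.coeff]
  have hrad : 0 < s.radius := by
    refine lt_of_lt_of_le ?_ (s.le_radius_of_bound K (r := q⁻¹.toNNReal) fun n => ?_)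
    · exact ENNReal.coe_pos.2 (Real.toNNReal_pos.2 (inv_pos.2 hq))
    · rw [s.norm_apply_eq_norm_coef, hs, Real.coe_toNNReal _ (inv_pos.2 hq).le, inv_pow,
        ← div_eq_mul_inv, div_le_iff₀ (by positivity)]
      exact hb n
  have hsum := ((s.hasFPowerSeriesOnBall hrad).comp_sub c).hasFPowerSeriesAt
  rw [zero_add] at hsum
  exact ⟨_, s, hsum, hs⟩

theorem exists_hasDerivAt_mul [CompleteSpace E] {A : 𝕜 → E} {c : 𝕜} (hA : AnalyticAt 𝕜 A c) :
    ∃ Y : 𝕜 → E, Y c = 1 ∧ ∀ᶠ w in 𝓝 c, HasDerivAt Y (A w * Y w) w := by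
  obtain ⟨p, hp⟩ := hA
  obtain ⟨q, hq, hpq⟩ := exists_norm_coeff_le_pow_succ hp.radius_pos
  obtain ⟨Y, s, hs, hcoeff⟩ :=
    exists_hasFPowerSeriesAt hq (norm_solutionCoeff_le (𝕜 := 𝕜) hpq) c
  refine ⟨Y, ?_, ?_⟩
  · rw [← solutionCoeff_zero (𝕜 := 𝕜) p.coeff, ← hcoeff]
    exact (hs.coeff_zero _).symm
  filter_upwards [hs.eventually_differentiableAt, eventually_hasSum_deriv hs,
    hasFPowerSeriesAt_iff'.1 hp, hasFPowerSeriesAt_iff'.1 hs, eventually_summable_norm hp,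
    eventually_summable_norm hs] with w hdiff hderiv hAw hYw hAsum hYsum
  suffices h : deriv Y w = A w * Y w by simpa only [h] using hdiff.hasDerivAt
  refine hderiv.unique ?_
  have hprod := hasSum_sum_range_mul_of_summable_norm hAsum hYsum
  rw [hAw.tsum_eq, hYw.tsum_eq] at hprod
  convert! hprod using 2 with n
  rw [hcoeff, succ_smul_solutionCoeff_succ, Finset.smul_sum]
  refine Finset.sum_congr rfl fun i hi => ?_
  rw [hcoeff, smul_mul_smul_comm, ← pow_add,
    Nat.add_sub_cancel' (Finset.mem_range_succ_iff.1 hi)]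

end LinearODE

section Deriv

variable {𝕜 F : Type*} [RCLike 𝕜] [NormedAddCommGroup F] [NormedSpace 𝕜 F]

theorem eventually_eq_of_hasDerivAt_zero {f : 𝕜 → F} {c : 𝕜}
    (h : ∀ᶠ w in 𝓝 c, HasDerivAt f 0 w) : ∀ᶠ w in 𝓝 c, f w = f c := by
  obtain ⟨ε, hε, hb⟩ := Metric.eventually_nhds_iff_ball.1 h
  filter_upwards [Metric.ball_mem_nhds c hε] with w hw
  exact Metric.isOpen_ball.is_const_of_deriv_eq_zero (Metric.isPreconnected_ball)
    (fun x hx => (hb x hx).differentiableAt.differentiableWithinAt)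
    (fun x hx => (hb x hx).deriv) hw (Metric.mem_ball_self hε)

end Deriv

/-! ### Calculus of matrix-valued functions -/

section MatrixCalculus

variable {r : ℕ}

/-- The matrix-valued function `M` has the entrywise complex derivative `M'` at `w`. -/
def HasMatDerivAt (M : ℂ → Mat r) (M' : Mat r) (w : ℂ) : Prop :=
  ∀ a b, HasDerivAt (fun u => M u a b) (M' a b) w

theorem HasMatDerivAt.matDeriv {f : ℂ → Mat r} {f' : Mat r} {w : ℂ} (h : HasMatDerivAt f f' w) :
    matDeriv f w = f' :=
  Matrix.ext fun a b => (h a b).deriv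

theorem HasMatDerivAt.mul {M N : ℂ → Mat r} {M' N' : Mat r} {w : ℂ}
    (hM : HasMatDerivAt M M' w) (hN : HasMatDerivAt N N' w) :
    HasMatDerivAt (fun u => M u * N u) (M' * N w + M w * N') w := fun a b => by
  simp only [Matrix.mul_apply, Matrix.add_apply, ← Finset.sum_add_distrib]
  exact HasDerivAt.fun_sum fun c _ => (hM a c).mul (hN c b)

theorem HasMatDerivAt.mul_const {M : ℂ → Mat r} {M' : Mat r} {w : ℂ}
    (hM : HasMatDerivAt M M' w) (C : Mat r) : HasMatDerivAt (fun u => M u * C) (M' * C) w := by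
  simpa using hM.mul (N := fun _ => C) (N' := 0) fun _ _ => hasDerivAt_const _ _

theorem HasMatDerivAt.smul {c : ℂ → ℂ} {c' : ℂ} {M : ℂ → Mat r} {M' : Mat r} {w : ℂ}
    (hc : HasDerivAt c c' w) (hM : HasMatDerivAt M M' w) :
    HasMatDerivAt (fun u => c u • M u) (c' • M w + c w • M') w :=
  fun a b => hc.mul (hM a b)

theorem HasMatDerivAt.transpose {M : ℂ → Mat r} {M' : Mat r} {w : ℂ}
    (hM : HasMatDerivAt M M' w) : HasMatDerivAt (fun u => (M u).transpose) M'.transpose w :=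
  fun a b => hM b a

theorem eventually_eq_of_hasMatDerivAt_zero {M : ℂ → Mat r} {c : ℂ}
    (h : ∀ᶠ w in 𝓝 c, HasMatDerivAt M 0 w) : ∀ᶠ w in 𝓝 c, M w = M c := by
  have hentry : ∀ᶠ w in 𝓝 c, ∀ a b, M w a b = M c a b :=
    eventually_all.2 fun a => eventually_all.2 fun b =>
      eventually_eq_of_hasDerivAt_zero (h.mono fun w hw => hw a b)
  exact hentry.mono fun w hw => Matrix.ext hw

theorem IsEntire.hasMatDerivAt {f : ℂ → Mat r} (hf : IsEntire f) (w : ℂ) :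
    HasMatDerivAt f (RHGauge.matDeriv f w) w :=
  fun a b => (hf a b w).hasDerivAt

theorem IsEntire.add {f g : ℂ → Mat r} (hf : IsEntire f) (hg : IsEntire g) :
    IsEntire fun w => f w + g w := fun a b => (hf a b).add (hg a b)

theorem IsEntire.sub {f g : ℂ → Mat r} (hf : IsEntire f) (hg : IsEntire g) :
    IsEntire fun w => f w - g w := fun a b => (hf a b).sub (hg a b)

theorem IsEntire.mul {f g : ℂ → Mat r} (hf : IsEntire f) (hg : IsEntire g) :
    IsEntire fun w => f w * g w := fun a b w =>
  ((hf.hasMatDerivAt w).mul (hg.hasMatDerivAt w) a b).differentiableAt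

theorem IsEntire.sum {ι : Type*} (s : Finset ι) {f : ι → ℂ → Mat r} (hf : ∀ i, IsEntire (f i)) :
    IsEntire fun w => ∑ i ∈ s, f i w := fun a b => by
  simp only [Matrix.sum_apply]
  exact Differentiable.fun_sum fun i _ => hf i a b

theorem isEntire_const (C : Mat r) : IsEntire fun _ => C := fun _ _ => differentiable_const _

theorem IsEntire.matDeriv {f : ℂ → Mat r} (hf : IsEntire f) : IsEntire (matDeriv f) :=
  fun a b => (hf a b).deriv

theorem matDeriv_mul {f g : ℂ → Mat r} (hf : IsEntire f) (hg : IsEntire g) (w : ℂ) :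
    matDeriv (fun u => f u * g u) w = matDeriv f w * g w + f w * matDeriv g w :=
  ((hf.hasMatDerivAt w).mul (hg.hasMatDerivAt w)).matDeriv

theorem matDeriv_const (C : Mat r) (w : ℂ) : matDeriv (fun _ => C) w = 0 :=
  HasMatDerivAt.matDeriv (f' := 0) fun _ _ => hasDerivAt_const _ _

theorem differentiable_det {n : Type*} [Fintype n] [DecidableEq n] {f : ℂ → Matrix n n ℂ}
    (hf : ∀ a b, Differentiable ℂ fun w => f w a b) : Differentiable ℂ fun w => (f w).det := by
  simp only [Matrix.det_apply]
  exact Differentiable.fun_sum fun σ _ =>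
    (Differentiable.fun_finsetProd fun i _ => hf _ _).const_smul _

theorem differentiable_adjugate {n : Type*} [Fintype n] [DecidableEq n] {f : ℂ → Matrix n n ℂ}
    (hf : ∀ a b, Differentiable ℂ fun w => f w a b) (a b : n) :
    Differentiable ℂ fun w => (f w).adjugate a b := by
  simp only [Matrix.adjugate_apply]
  refine differentiable_det fun c d => ?_
  by_cases hc : c = b
  · simp [hc]
  · simpa [Matrix.updateRow_apply, hc] using hf c d

theorem IsEntire.inv {g : ℂ → GL (Fin r) ℂ} (hg : IsEntire fun w => (g w : Mat r)) :
    IsEntire fun w => (((g w)⁻¹ : GL (Fin r) ℂ) : Mat r) := fun a b => by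
  simp only [Matrix.coe_units_inv, Matrix.inv_def, Ring.inverse_eq_inv, Matrix.smul_apply,
    smul_eq_mul]
  have hdet (w : ℂ) : (g w : Mat r).det ≠ 0 :=
    ((Matrix.isUnit_iff_isUnit_det _).1 (g w).isUnit).ne_zero
  exact ((differentiable_det hg).inv hdet).mul (differentiable_adjugate hg a b)

end MatrixCalculus

/-! ### Local solutions -/

section LocalSolutions

attribute [local instance] Matrix.linftyOpNormedRing Matrix.linftyOpNormedAlgebra

theorem exists_hasMatDerivAt_mul {r : ℕ} {A : ℂ → Mat r} {c : ℂ}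
    (hA : ∀ a b, AnalyticAt ℂ (fun w => A w a b) c) :
    ∃ Y : ℂ → Mat r, Y c = 1 ∧ ∀ᶠ w in 𝓝 c, HasMatDerivAt Y (A w * Y w) w := by
  have hA' : AnalyticAt ℂ A c := by
    have hsum : A = fun w => ∑ a, ∑ b, A w a b • Matrix.single a b (1 : ℂ) := by
      funext w
      simpa [Matrix.smul_single] using Matrix.matrix_eq_sum_single (A w)
    rw [hsum]
    exact Finset.analyticAt_fun_sum _ fun a _ => Finset.analyticAt_fun_sum _ fun b _ =>
      (hA a b).smul analyticAt_const
  obtain ⟨Y, hY, hd⟩ := exists_hasDerivAt_mul hA'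
  exact ⟨Y, hY, hd.mono fun w hw a b =>
    (Matrix.entryLinearMap ℂ ℂ a b).toContinuousLinearMap.hasFDerivAt.comp_hasDerivAt w hw⟩

end LocalSolutions

/-- A fundamental solution `Φ` of `dY + A Y = 0` near `c`, normalized at `c`.  Its inverse `Ψ`,
which solves the adjoint equation, is part of the data. -/
structure LocalFrame {r : ℕ} (A : ℂ → Mat r) (c : ℂ) where
  Φ : ℂ → Mat r
  Ψ : ℂ → Mat r
  s : Set ℂ
  isOpen : IsOpen s
  mem : c ∈ s
  apply_self : Φ c = 1
  deriv_Φ : ∀ w ∈ s, HasMatDerivAt Φ (-(A w * Φ w)) w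
  deriv_Ψ : ∀ w ∈ s, HasMatDerivAt Ψ (Ψ w * A w) w
  mul_eq_one : ∀ w ∈ s, Ψ w * Φ w = 1

theorem exists_localFrame {r : ℕ} {A : ℂ → Mat r} {c : ℂ}
    (hA : ∀ a b, AnalyticAt ℂ (fun w => A w a b) c) : Nonempty (LocalFrame A c) := by
  obtain ⟨Φ, hΦ, hΦd⟩ := exists_hasMatDerivAt_mul (A := fun w => -A w) fun a b => (hA a b).neg
  obtain ⟨Θ, hΘ, hΘd⟩ := exists_hasMatDerivAt_mul (A := fun w => (A w).transpose)
    fun a b => hA b a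
  have hΨd : ∀ᶠ w in 𝓝 c,
      HasMatDerivAt (fun u => (Θ u).transpose) ((Θ w).transpose * A w) w :=
    hΘd.mono fun w hw => by simpa [Matrix.transpose_mul] using hw.transpose
  have hmul : ∀ᶠ w in 𝓝 c, (Θ w).transpose * Φ w = 1 := by
    have hzero : ∀ᶠ w in 𝓝 c, HasMatDerivAt (fun u => (Θ u).transpose * Φ u) 0 w :=
      (hΨd.and hΦd).mono fun w hw => by simpa [Matrix.mul_assoc] using hw.1.mul hw.2
    simpa [hΦ, hΘ] using eventually_eq_of_hasMatDerivAt_zero hzero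
  obtain ⟨s, hs, hso, hsc⟩ := eventually_nhds_iff.1 ((hΦd.and hΨd).and hmul)
  exact ⟨⟨Φ, fun u => (Θ u).transpose, s, hso, hsc, hΦ,
    fun w hw => by simpa using (hs w hw).1.1, fun w hw => (hs w hw).1.2,
    fun w hw => (hs w hw).2⟩⟩

theorem LocalFrame.eventually_mul_eq {r : ℕ} {A : ℂ → Mat r} {c c' x : ℂ} (S : LocalFrame A c)
    (T : LocalFrame A c') (hS : x ∈ S.s) (hT : x ∈ T.s) :
    ∀ᶠ w in 𝓝 x, T.Ψ w * S.Φ w = T.Ψ x * S.Φ x := by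
  refine eventually_eq_of_hasMatDerivAt_zero ?_
  filter_upwards [S.isOpen.mem_nhds hS, T.isOpen.mem_nhds hT] with w hwS hwT
  simpa [Matrix.mul_assoc] using (T.deriv_Ψ w hwT).mul (S.deriv_Φ w hwS)

theorem LocalFrame.mul_eq_one' {r : ℕ} {A : ℂ → Mat r} {c w : ℂ} (S : LocalFrame A c)
    (hw : w ∈ S.s) : S.Φ w * S.Ψ w = 1 :=
  mul_eq_one_comm.1 (S.mul_eq_one w hw)

/-! ### The covering of local solutions -/

/-- Matrices with the discrete topology: the fiber of the covering of local solutions. -/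
def DiscreteMat (r : ℕ) := Mat r

instance (r : ℕ) : TopologicalSpace (DiscreteMat r) := ⊥
instance (r : ℕ) : DiscreteTopology (DiscreteMat r) := ⟨rfl⟩

/-- The matrix underlying a point of the discrete space of matrices. -/
def DiscreteMat.toMat {r : ℕ} (v : DiscreteMat r) : Mat r := v

section Covering

variable {r k : ℕ} {z : Fin k → ℂ} {A : ℂ → Mat r}

/-- The transition of the covering of local solutions: it sends the coefficient `v` of the
solution `Φ v` in the local frame `Φ` of `S` to its coefficient in the frame of `T`. -/
def LocalFrame.transition {c c' : ℂ} (S : LocalFrame A c) (T : LocalFrame A c') (x : ℂ)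
    (v : DiscreteMat r) : DiscreteMat r :=
  (T.Ψ x * S.Φ x * v.toMat : Mat r)

theorem LocalFrame.transition_self {c x : ℂ} (S : LocalFrame A c) (hx : x ∈ S.s)
    (v : DiscreteMat r) : S.transition S x v = v := by
  rw [transition, S.mul_eq_one x hx, one_mul]
  rfl

theorem LocalFrame.transition_transition {c c' c'' x : ℂ} (S : LocalFrame A c)
    (T : LocalFrame A c') (U : LocalFrame A c'') (hx : x ∈ T.s) (v : DiscreteMat r) :
    T.transition U x (S.transition T x v) = S.transition U x v := by
  change U.Ψ x * T.Φ x * (T.Ψ x * S.Φ x * v.toMat) = U.Ψ x * S.Φ x * v.toMat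
  calc _ = U.Ψ x * (T.Φ x * T.Ψ x) * S.Φ x * v.toMat := by simp only [Matrix.mul_assoc]
    _ = _ := by rw [T.mul_eq_one' hx, mul_one]

theorem LocalFrame.continuousAt_transition {c c' : ℂ} (S : LocalFrame A c) (T : LocalFrame A c')
    {p : Punctured z × DiscreteMat r} (hS : (p.1 : ℂ) ∈ S.s) (hT : (p.1 : ℂ) ∈ T.s) :
    ContinuousAt (fun q : Punctured z × DiscreteMat r => S.transition T q.1 q.2) p := by
  have hfst : ∀ᶠ q : Punctured z × DiscreteMat r in 𝓝 p,
      T.Ψ q.1 * S.Φ q.1 = T.Ψ p.1 * S.Φ p.1 :=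
    ((continuous_subtype_val.comp continuous_fst).tendsto p).eventually
      (S.eventually_mul_eq T hS hT)
  have hsnd : ∀ᶠ q : Punctured z × DiscreteMat r in 𝓝 p, q.2 = p.2 :=
    (continuous_snd.tendsto p).eventually (p := fun v => v = p.2) (by simp)
  refine tendsto_const_nhds.congr' ?_
  filter_upwards [hfst, hsnd] with q hq hq'
  rw [transition, transition, hq, hq']

/-- The covering of the punctured sphere by the values of local solutions of `dY + A Y = 0`. -/
noncomputable def solutionBundle (S : ∀ c : Punctured z, LocalFrame A c) :
    FiberBundleCore (Punctured z) (Punctured z) (DiscreteMat r) where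
  baseSet i := (fun w : Punctured z => (w : ℂ)) ⁻¹' (S i).s
  isOpen_baseSet i := (S i).isOpen.preimage continuous_subtype_val
  indexAt := id
  mem_baseSet_at i := (S i).mem
  coordChange i j x := (S i).transition (S j) x
  coordChange_self i _ hx := (S i).transition_self hx
  continuousOn_coordChange i j _ hp :=
    ((S i).continuousAt_transition (S j) hp.1.1 hp.1.2).continuousWithinAt
  coordChange_comp i j l _ hx v := (S i).transition_transition (S j) (S l) hx.1.2 v

variable (S : ∀ c : Punctured z, LocalFrame A c)

/-- The point over `x` with value `C` of the covering of local solutions. -/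
def solutionPoint (x : Punctured z) (C : Mat r) : (solutionBundle S).TotalSpace := ⟨x, C⟩

/-- The value of a point of the covering of local solutions. -/
def solutionValue (e : (solutionBundle S).TotalSpace) : Mat r := e.2

theorem isCoveringMap_solutionBundle : IsCoveringMap (solutionBundle S).proj :=
  FiberBundle.isCoveringMap (F := DiscreteMat r) (E := (solutionBundle S).Fiber)

theorem localTriv_solutionBundle (i : Punctured z) (e : (solutionBundle S).TotalSpace) :
    ((solutionBundle S).localTriv i e).2 = ((S i).Ψ e.1 * solutionValue S e : Mat r) := by
  change (S i).Ψ e.1 * (S e.1).Φ e.1 * solutionValue S e = _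
  rw [(S e.1).apply_self, mul_one]

theorem eventually_localTriv_eq (e : (solutionBundle S).TotalSpace) :
    ∀ᶠ e' in 𝓝 e, (S e.1).Ψ e'.1 * solutionValue S e' = (S e.1).Ψ e.1 * solutionValue S e := by
  have hc : ContinuousAt (fun e' => ((solutionBundle S).localTriv e.1 e').2) e :=
    continuous_snd.continuousAt.comp
      (((solutionBundle S).localTriv e.1).continuousAt (S e.1).mem)
  have hev := hc.eventually (p := fun v => v = ((solutionBundle S).localTriv e.1 e).2) (by simp)
  filter_upwards [hev] with e' he'
  rwa [localTriv_solutionBundle, localTriv_solutionBundle] at he'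

theorem isContinuation_of_lift {x y : Punctured z} (γ : Path x y)
    {Γ : unitInterval → (solutionBundle S).TotalSpace} (hΓ : Continuous Γ)
    (hlift : ∀ t, (Γ t).1 = γ t) : IsContinuation z A γ fun t => solutionValue S (Γ t) := by
  intro t
  set c := (Γ t).1
  set C := (S c).Ψ c * solutionValue S (Γ t) with hC
  refine ⟨fun u => (S c).Φ u * C, ?_, ?_⟩
  · rw [← hlift]
    filter_upwards [(S c).isOpen.mem_nhds (S c).mem] with w hw
    have hd : HasMatDerivAt (fun u => (S c).Φ u * C) (-(A w * ((S c).Φ w * C))) w := by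
      simpa [Matrix.mul_assoc] using ((S c).deriv_Φ w hw).mul_const C
    exact hd
  · have hconst := (hΓ.tendsto t).eventually (eventually_localTriv_eq S (Γ t))
    have hmem : ∀ᶠ s in 𝓝 t, ((γ s : Punctured z) : ℂ) ∈ (S c).s := by
      refine (continuous_subtype_val.comp γ.continuous).continuousAt.eventually
        ((S c).isOpen.mem_nhds ?_)
      simp only [Function.comp, ← hlift]
      exact (S c).mem
    filter_upwards [hconst, hmem] with s hs hs'
    rw [← hlift] at hs' ⊢
    rw [hC, ← hs, ← Matrix.mul_assoc, (S c).mul_eq_one' hs', one_mul]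

/-- Right multiplication by a constant matrix on the covering of local solutions. -/
def solutionMulRight (C : Mat r) (e : (solutionBundle S).TotalSpace) :
    (solutionBundle S).TotalSpace := solutionPoint S e.1 (solutionValue S e * C)

theorem continuous_solutionMulRight (C : Mat r) : Continuous (solutionMulRight S C) := by
  rw [continuous_iff_continuousAt]
  intro e
  rw [FiberBundle.continuousAt_totalSpace]
  refine ⟨(isCoveringMap_solutionBundle S).continuous.continuousAt (x := e), ?_⟩
  refine tendsto_const_nhds.congr' ?_
  filter_upwards [eventually_localTriv_eq S e] with e' he'
  refine (localTriv_solutionBundle S e.1 (solutionMulRight S C e)).trans <| Eq.trans ?_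
    (localTriv_solutionBundle S e.1 (solutionMulRight S C e')).symm
  change (S e.1).Ψ e.1 * (solutionValue S e * C) = (S e.1).Ψ e'.1 * (solutionValue S e' * C)
  rw [← Matrix.mul_assoc, ← Matrix.mul_assoc, he']

theorem liftPath_solutionMulRight (C : Mat r) (γ : C(unitInterval, Punctured z))
    (e : (solutionBundle S).TotalSpace) (h : γ 0 = (solutionBundle S).proj e) :
    solutionMulRight S C ((isCoveringMap_solutionBundle S).liftPath γ e h 1) =
      (isCoveringMap_solutionBundle S).liftPath γ (solutionMulRight S C e) h 1 := by
  have hc := isCoveringMap_solutionBundle S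
  refine congrFun (?_ : solutionMulRight S C ∘ hc.liftPath γ e h =
    hc.liftPath γ (solutionMulRight S C e) h) 1
  refine (hc.eq_liftPath_iff (e := solutionMulRight S C e) h).2
    ⟨(continuous_solutionMulRight S C).comp (hc.liftPath γ e h).continuous, ?_, ?_⟩
  · exact hc.liftPath_lifts γ e h
  · simp [hc.liftPath_zero]

/-- The monodromy of the covering of local solutions, as a homomorphism to the monoid of
matrices. -/
noncomputable def monodromyHom (x₀ : Punctured z) :
    FundamentalGroup (Punctured z) x₀ →* Mat r where
  toFun p := solutionValue S ((isCoveringMap_solutionBundle S).monodromy (x := x₀) (y := x₀) p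
    ⟨solutionPoint S x₀ 1, rfl⟩).1
  map_one' := by
    rw [FundamentalGroup.one_def, IsCoveringMap.monodromy_refl]
    rfl
  map_mul' p q := by
    have hc := isCoveringMap_solutionBundle S
    rw [FundamentalGroup.mul_def, IsCoveringMap.monodromy_trans_apply]
    induction p using Path.Homotopic.Quotient.ind with | mk p => ?_
    generalize hc.monodromy (x := x₀) (y := x₀) q ⟨solutionPoint S x₀ 1, rfl⟩ = e
    have he : solutionMulRight S (solutionValue S e.1) (solutionPoint S x₀ 1) = e.1 := by
      obtain ⟨⟨x, v⟩, hx⟩ := e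
      obtain rfl : x = x₀ := hx
      exact congrArg (solutionPoint S x) (one_mul (M := Mat r) v)
    have hlift := liftPath_solutionMulRight S (solutionValue S e.1)
      (p : C(unitInterval, Punctured z)) (solutionPoint S x₀ 1) p.source
    simp only [he] at hlift
    exact congrArg (solutionValue S) hlift.symm

end Covering

theorem exists_isMonodromyRep {r k : ℕ} {z : Fin k → ℂ} {A : ℂ → Mat r}
    (hA : ∀ c : Punctured z, ∀ a b, AnalyticAt ℂ (fun w => A w a b) c) (x₀ : Punctured z) :
    ∃ ρ : FundamentalGroup (Punctured z) x₀ →* GL (Fin r) ℂ, IsMonodromyRep z A x₀ ρ := by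
  let S : ∀ c : Punctured z, LocalFrame A c := fun c => (exists_localFrame (hA c)).some
  have hc := isCoveringMap_solutionBundle S
  refine ⟨(monodromyHom S x₀).toHomUnits, fun γ =>
    ⟨fun t => solutionValue S (hc.liftPath γ (solutionPoint S x₀ 1) γ.source t), ?_, ?_, rfl⟩⟩
  · exact isContinuation_of_lift S γ (hc.liftPath γ _ _).continuous
      (congrFun (hc.liftPath_lifts γ _ γ.source))
  · exact congrArg (solutionValue S) (hc.liftPath_zero (γ : C(unitInterval, Punctured z))
      (solutionPoint S x₀ 1) γ.source)

/-! ### Holomorphic germs and Liouville's theorem -/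

section Germs

theorem analyticAt_dslope {f : ℂ → ℂ} (hf : AnalyticAt ℂ f 0) : AnalyticAt ℂ (dslope f 0) 0 :=
  let ⟨_, hp⟩ := hf
  hp.has_fpower_series_dslope_fslope.analyticAt

theorem eq_add_mul_dslope (f : ℂ → ℂ) (w : ℂ) : f w = f 0 + w * dslope f 0 w := by
  simpa [sub_eq_iff_eq_add'] using (sub_smul_dslope f 0 w).symm

theorem eq_const_of_tendsto_inv {F : Type*} [NormedAddCommGroup F] [NormedSpace ℂ F] {f : ℂ → F}
    (hf : Differentiable ℂ f) {c : F} (h : Tendsto (fun ζ => f ζ⁻¹) (𝓝[≠] 0) (𝓝 c)) (w : ℂ) :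
    f w = c := by
  refine hf.apply_eq_of_tendsto_cocompact w ?_
  rw [← Metric.cobounded_eq_cocompact]
  simpa [Function.comp_def] using h.comp (tendsto_inv₀_cobounded' (α := ℂ))

variable {r : ℕ} {f g : ℂ → Mat r}

theorem IsHolomorphicAtZero.mul (hf : IsHolomorphicAtZero f) (hg : IsHolomorphicAtZero g) :
    IsHolomorphicAtZero fun w => f w * g w := fun a b => by
  simp only [Matrix.mul_apply]
  exact Finset.analyticAt_fun_sum _ fun c _ => (hf a c).mul (hg c b)

theorem IsHolomorphicAtZero.add (hf : IsHolomorphicAtZero f) (hg : IsHolomorphicAtZero g) :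
    IsHolomorphicAtZero fun w => f w + g w :=
  fun a b => (hf a b).add (hg a b)

theorem IsHolomorphicAtZero.sub (hf : IsHolomorphicAtZero f) (hg : IsHolomorphicAtZero g) :
    IsHolomorphicAtZero fun w => f w - g w :=
  fun a b => (hf a b).sub (hg a b)

theorem IsHolomorphicAtZero.smul (hf : IsHolomorphicAtZero f) :
    IsHolomorphicAtZero fun w => w • f w :=
  fun a b => analyticAt_id.mul (hf a b)

theorem IsHolomorphicAtZero.tendsto (hf : IsHolomorphicAtZero f) :
    Tendsto f (𝓝[≠] 0) (𝓝 (f 0)) :=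
  Tendsto.mono_left (tendsto_pi_nhds.2 fun a => tendsto_pi_nhds.2 fun b =>
    (hf a b).continuousAt) nhdsWithin_le_nhds

theorem IsHolomorphicAtZero.matDeriv (hf : IsHolomorphicAtZero f) :
    IsHolomorphicAtZero (matDeriv f) :=
  fun a b => (hf a b).deriv

theorem isHolomorphicAtZero_const (C : Mat r) : IsHolomorphicAtZero fun _ => C :=
  fun _ _ => analyticAt_const

theorem IsEntire.isHolomorphicAtZero (hf : IsEntire f) : IsHolomorphicAtZero f :=
  fun a b => (hf a b).analyticAt 0

theorem IsHolomorphicAtZero.exists_smul_eq (hf : IsHolomorphicAtZero f) :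
    ∃ h : ℂ → Mat r, IsHolomorphicAtZero h ∧ ∀ ζ, ζ ≠ 0 → ζ⁻¹ • f ζ = ζ⁻¹ • f 0 + h ζ := by
  refine ⟨fun ζ => Matrix.of fun a b => dslope (fun u => f u a b) 0 ζ,
    fun a b => analyticAt_dslope (hf a b), fun ζ hζ => Matrix.ext fun a b => ?_⟩
  simp only [Matrix.smul_apply, Matrix.add_apply, Matrix.of_apply, smul_eq_mul]
  rw [eq_add_mul_dslope (fun u => f u a b) ζ]
  field_simp

theorem IsEntire.exists_smul_eq (hf : IsEntire f) (c : ℂ) :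
    ∃ h : ℂ → Mat r, IsEntire h ∧
      ∀ w, w ≠ c → (w - c)⁻¹ • f w = (w - c)⁻¹ • f c + h w := by
  refine ⟨fun w => Matrix.of fun a b => dslope (fun u => f u a b) c w, fun a b => ?_,
    fun w hw => Matrix.ext fun a b => ?_⟩
  · exact differentiableOn_univ.1
      ((Complex.differentiableOn_dslope (c := c) univ_mem).2 (hf a b).differentiableOn)
  · simp only [Matrix.smul_apply, Matrix.add_apply, Matrix.of_apply, dslope_of_ne _ hw, slope,
      vsub_eq_sub, smul_eq_mul]
    ring

theorem IsEntire.eq_const_of_tendsto_inv (hf : IsEntire f) {C : Mat r}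
    (h : Tendsto (fun ζ => f ζ⁻¹) (𝓝[≠] 0) (𝓝 C)) (w : ℂ) : f w = C :=
  Matrix.ext fun a b => RHGauge.eq_const_of_tendsto_inv (hf a b)
    (tendsto_pi_nhds.1 (tendsto_pi_nhds.1 h a) b) w

end Germs

/-! ### Diagonal powers, conjugation and flags -/

section Matrices

variable {r : ℕ}

theorem powMat_mul_powMat_neg (m : Fin r → ℤ) {w : ℂ} (hw : w ≠ 0) :
    powMat m w * powMat (fun j => -m j) w = 1 := by
  simp [powMat, zpow_neg, hw, zpow_ne_zero, Matrix.diagonal_mul_diagonal]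

theorem powMat_neg_mul_powMat (m : Fin r → ℤ) {w : ℂ} (hw : w ≠ 0) :
    powMat (fun j => -m j) w * powMat m w = 1 :=
  mul_eq_one_comm.1 (powMat_mul_powMat_neg m hw)

theorem powMat_inv (m : Fin r → ℤ) (w : ℂ) : powMat m w⁻¹ = powMat (fun j => -m j) w := by
  simp [powMat]

theorem powMat_neg_inv (m : Fin r → ℤ) (w : ℂ) : powMat (fun j => -m j) w⁻¹ = powMat m w := by
  simp [powMat]

theorem powMat_conj_apply (m : Fin r → ℤ) {w : ℂ} (hw : w ≠ 0) (X : Mat r) (a b : Fin r) :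
    (powMat m w * X * powMat (fun j => -m j) w) a b = w ^ (m a - m b) * X a b := by
  simp only [powMat, Matrix.mul_diagonal, Matrix.diagonal_mul]
  rw [sub_eq_add_neg, zpow_add₀ hw]; ring

theorem powMat_neg_conj_apply (m : Fin r → ℤ) {w : ℂ} (hw : w ≠ 0) (X : Mat r) (a b : Fin r) :
    (powMat (fun j => -m j) w * X * powMat m w) a b = w ^ (m b - m a) * X a b := by
  simp only [powMat, Matrix.mul_diagonal, Matrix.diagonal_mul]
  rw [sub_eq_neg_add, zpow_add₀ hw]; ring

theorem Ad_mul (g h : GL (Fin r) ℂ) (X : Mat r) : Ad (g * h) X = Ad g (Ad h X) := by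
  simp only [Ad, Units.val_mul, mul_inv_rev, Matrix.mul_assoc]

theorem Ad_add (g : GL (Fin r) ℂ) (X Y : Mat r) : Ad g (X + Y) = Ad g X + Ad g Y := by
  simp only [Ad, mul_add, add_mul]

theorem Ad_smul (g : GL (Fin r) ℂ) (c : ℂ) (X : Mat r) : Ad g (c • X) = c • Ad g X := by
  simp only [Ad, mul_smul_comm, smul_mul_assoc]

theorem Ad_sum {ι : Type*} (s : Finset ι) (g : GL (Fin r) ℂ) (X : ι → Mat r) :
    Ad g (∑ i ∈ s, X i) = ∑ i ∈ s, Ad g (X i) := by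
  simp only [Ad, Finset.mul_sum, Finset.sum_mul]

theorem Ad_one (X : Mat r) : Ad 1 X = X := by simp [Ad]

theorem Ad_permGL (σ : Equiv.Perm (Fin r)) (X : Mat r) :
    Ad (permGL σ) X = X.submatrix σ σ := by
  change σ.permMatrix ℂ * X * σ⁻¹.permMatrix ℂ = _
  rw [Equiv.Perm.permMatrix, Equiv.Perm.permMatrix, PEquiv.toMatrix_toPEquiv_mul,
    PEquiv.mul_toMatrix_toPEquiv, Matrix.submatrix_submatrix]
  rfl

theorem eq_Ad_sub_of_mul_eq {g : GL (Fin r) ℂ} {X Y D : Mat r} (h : X * g = g * Y - D) :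
    X = Ad g Y - D * ((g⁻¹ : GL (Fin r) ℂ) : Mat r) := by
  rw [Ad, ← sub_mul, ← h, Matrix.mul_assoc, Units.mul_inv, mul_one]

theorem normalResidue_eq (m : Fin r → ℤ) (a : Fin r → ℝ) (σ : Equiv.Perm (Fin r)) :
    normalResidue m a σ = Matrix.diagonal fun j => (m j : ℂ) + a (σ j) := by
  rw [normalResidue, Ad_add, ← Ad_mul, mul_inv_cancel, Ad_one, Ad_permGL, weightMat, splitMat,
    Matrix.submatrix_diagonal_equiv, Matrix.diagonal_add]
  simp only [Function.comp, add_comm]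

theorem act_flagOfFrame (g B : GL (Fin r) ℂ) :
    (flagOfFrame B).act g = flagOfFrame (g * B) := by
  ext1
  funext j
  simp only [CompleteFlag.act, flagOfFrame, Submodule.map_span, Set.image_image]
  congr 1

end Matrices

/-! ### The gauge group -/

namespace BundleAut

variable {r : ℕ} {m : Fin r → ℤ}

theorem ext_of_charts {g h : BundleAut m} (h0 : g.g0 = h.g0) (h1 : g.g1 = h.g1) : g = h := by
  cases g; cases h; congr

noncomputable instance : Mul (BundleAut m) where
  mul h g :=
    { g0 := h.g0 * g.g0
      g1 := h.g1 * g.g1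
      holo0 := by simpa using h.holo0.mul g.holo0
      holo1 := by simpa using h.holo1.mul g.holo1
      glue := fun w hw => by
        calc ((h.g0 w * g.g0 w : GL (Fin r) ℂ) : Mat r)
          _ = powMat m w * h.g1 w⁻¹ * (powMat (fun j => -m j) w * powMat m w) *
              g.g1 w⁻¹ * powMat (fun j => -m j) w := by
            rw [Units.val_mul, h.glue w hw, g.glue w hw]; simp only [Matrix.mul_assoc]
          _ = powMat m w * (h.g1 w⁻¹ * g.g1 w⁻¹ : GL (Fin r) ℂ) * powMat (fun j => -m j) w := by
            rw [powMat_neg_mul_powMat m hw, mul_one]; simp only [Units.val_mul, Matrix.mul_assoc] }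

noncomputable instance : One (BundleAut m) where
  one :=
    { g0 := 1
      g1 := 1
      holo0 := isEntire_const 1
      holo1 := isEntire_const 1
      glue := fun w hw => by simp [powMat_mul_powMat_neg m hw] }

theorem inv_g0_eq (g : BundleAut m) {w : ℂ} (hw : w ≠ 0) :
    (((g.g0 w)⁻¹ : GL (Fin r) ℂ) : Mat r) =
      powMat m w * (((g.g1 w⁻¹)⁻¹ : GL (Fin r) ℂ) : Mat r) * powMat (fun j => -m j) w := by
  refine Units.inv_eq_of_mul_eq_one_right ?_
  rw [g.glue w hw]
  calc _ = powMat m w * g.g1 w⁻¹ * (powMat (fun j => -m j) w * powMat m w) *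
        (((g.g1 w⁻¹)⁻¹ : GL (Fin r) ℂ) : Mat r) * powMat (fun j => -m j) w := by
        simp only [Matrix.mul_assoc]
    _ = powMat m w * (g.g1 w⁻¹ * (((g.g1 w⁻¹)⁻¹ : GL (Fin r) ℂ) : Mat r)) *
        powMat (fun j => -m j) w := by
        rw [powMat_neg_mul_powMat m hw]; simp only [Matrix.mul_assoc, one_mul]
    _ = 1 := by rw [Units.mul_inv, mul_one, powMat_mul_powMat_neg m hw]

noncomputable instance : Inv (BundleAut m) where
  inv g :=
    { g0 := g.g0⁻¹
      g1 := g.g1⁻¹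
      holo0 := IsEntire.inv g.holo0
      holo1 := IsEntire.inv g.holo1
      glue := fun _ hw => g.inv_g0_eq hw }

noncomputable instance : Group (BundleAut m) :=
  Group.ofLeftAxioms
    (fun f g h => ext_of_charts (mul_assoc f.g0 g.g0 h.g0) (mul_assoc f.g1 g.g1 h.g1))
    (fun g => ext_of_charts (one_mul g.g0) (one_mul g.g1))
    (fun g => ext_of_charts (inv_mul_cancel g.g0) (inv_mul_cancel g.g1))

theorem act_mul_g0 (g : BundleAut m) (A : ℂ → Mat r) (w : ℂ) :
    g.act A w * g.g0 w = g.g0 w * A w - matDeriv (fun u => (g.g0 u : Mat r)) w := by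
  rw [act, Ad, sub_mul, Matrix.mul_assoc, Units.inv_mul, mul_one, Matrix.mul_assoc, Units.inv_mul,
    mul_one]

theorem mul_act (h g : BundleAut m) (A : ℂ → Mat r) : (h * g).act A = h.act (g.act A) := by
  ext1 w
  refine ((h * g).g0 w).isUnit.mul_right_cancel ?_
  have hd : matDeriv (fun u => ((h * g).g0 u : Mat r)) w =
      matDeriv (fun u => (h.g0 u : Mat r)) w * g.g0 w +
        h.g0 w * matDeriv (fun u => (g.g0 u : Mat r)) w := matDeriv_mul h.holo0 g.holo0 w
  have hcoe : ((h * g).g0 w : Mat r) = h.g0 w * g.g0 w := rfl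
  rw [act_mul_g0, hd, hcoe, ← Matrix.mul_assoc, act_mul_g0, sub_mul,
    Matrix.mul_assoc _ (g.act A w), act_mul_g0, mul_sub, Matrix.mul_assoc]
  abel

theorem one_act (A : ℂ → Mat r) : (1 : BundleAut m).act A = A := by
  funext w
  change Ad 1 (A w) - matDeriv (fun _ => (1 : Mat r)) w * _ = A w
  rw [Ad_one, matDeriv_const, zero_mul, sub_zero]

theorem g0_inv_eq (g : BundleAut m) {ζ : ℂ} (hζ : ζ ≠ 0) :
    (g.g0 ζ⁻¹ : Mat r) = powMat (fun j => -m j) ζ * g.g1 ζ * powMat m ζ := by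
  rw [g.glue _ (inv_ne_zero hζ), powMat_inv, powMat_neg_inv, inv_inv]

theorem hasDerivAt_g0 (g : BundleAut m) {w : ℂ} (hw : w ≠ 0) (a b : Fin r) :
    HasDerivAt (fun u => (g.g0 u : Mat r) a b)
      ((m a - m b : ℤ) * w ^ (m a - m b - 1) * (g.g1 w⁻¹ : Mat r) a b +
        w ^ (m a - m b) * (matDeriv (fun u => (g.g1 u : Mat r)) w⁻¹ a b * -(w ^ 2)⁻¹)) w := by
  have hg1 : HasDerivAt (fun u : ℂ => (g.g1 u⁻¹ : Mat r) a b)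
      (matDeriv (fun u => (g.g1 u : Mat r)) w⁻¹ a b * -(w ^ 2)⁻¹) w :=
    (g.holo1.hasMatDerivAt w⁻¹ a b).comp (h₂ := fun u => (g.g1 u : Mat r) a b) w
      (hasDerivAt_inv hw)
  refine ((hasDerivAt_zpow (m a - m b) w (Or.inl hw)).mul hg1).congr_of_eventuallyEq ?_
  filter_upwards [isOpen_ne.mem_nhds hw] with u hu
  rw [g.glue u hu, powMat_conj_apply m hu]
  rfl

theorem powMat_mul_matDeriv_g0_inv (g : BundleAut m) {ζ : ℂ} (hζ : ζ ≠ 0) :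
    powMat m ζ * matDeriv (fun u => (g.g0 u : Mat r)) ζ⁻¹ * powMat (fun j => -m j) ζ =
      ζ • (splitMat m * (g.g1 ζ : Mat r) - (g.g1 ζ : Mat r) * splitMat m) -
        ζ ^ 2 • matDeriv (fun u => (g.g1 u : Mat r)) ζ := by
  ext a b
  have hd := (g.hasDerivAt_g0 (inv_ne_zero hζ) a b).deriv
  rw [powMat_conj_apply m hζ, show matDeriv (fun u => (g.g0 u : Mat r)) ζ⁻¹ a b = _ from hd]
  simp only [Matrix.sub_apply, Matrix.smul_apply, splitMat, Matrix.mul_diagonal,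
    Matrix.diagonal_mul, smul_eq_mul]
  rw [zpow_sub_one₀ (inv_ne_zero hζ), inv_zpow, inv_inv]
  have hz : ζ ^ (m a - m b) ≠ 0 := zpow_ne_zero _ hζ
  push_cast
  field_simp
  ring

theorem formAtInfty_act_mul (g : BundleAut m) (A : ℂ → Mat r) (ζ : ℂ) :
    formAtInfty (g.act A) ζ * g.g0 ζ⁻¹ = g.g0 ζ⁻¹ * formAtInfty A ζ +
      (ζ ^ 2)⁻¹ • matDeriv (fun u => (g.g0 u : Mat r)) ζ⁻¹ := by
  rw [formAtInfty, formAtInfty, smul_mul_assoc, act_mul_g0, smul_sub, mul_smul_comm, neg_smul,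
    neg_smul, sub_neg_eq_add]

theorem connAtInfty_act_mul (g : BundleAut m) (A : ℂ → Mat r) {ζ : ℂ} (hζ : ζ ≠ 0) :
    connAtInfty m (g.act A) ζ * g.g1 ζ =
      g.g1 ζ * connAtInfty m A ζ - matDeriv (fun u => (g.g1 u : Mat r)) ζ := by
  have hright : powMat (fun j => -m j) ζ * (g.g1 ζ : Mat r) =
      g.g0 ζ⁻¹ * powMat (fun j => -m j) ζ := by
    rw [g.g0_inv_eq hζ, Matrix.mul_assoc _ (powMat m ζ), powMat_mul_powMat_neg m hζ, mul_one]
  have hleft : powMat m ζ * (g.g0 ζ⁻¹ : Mat r) = g.g1 ζ * powMat m ζ := by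
    rw [g.g0_inv_eq hζ, ← Matrix.mul_assoc, ← Matrix.mul_assoc, powMat_mul_powMat_neg m hζ,
      one_mul]
  calc connAtInfty m (g.act A) ζ * g.g1 ζ
    _ = powMat m ζ * (formAtInfty (g.act A) ζ * g.g0 ζ⁻¹) * powMat (fun j => -m j) ζ -
        ζ⁻¹ • (splitMat m * (g.g1 ζ : Mat r)) := by
      rw [connAtInfty, sub_mul, Matrix.mul_assoc _ _ (g.g1 ζ : Mat r), hright, smul_mul_assoc]
      simp only [Matrix.mul_assoc]
    _ = powMat m ζ * g.g0 ζ⁻¹ * formAtInfty A ζ * powMat (fun j => -m j) ζ +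
        (ζ ^ 2)⁻¹ • (powMat m ζ * matDeriv (fun u => (g.g0 u : Mat r)) ζ⁻¹ *
          powMat (fun j => -m j) ζ) - ζ⁻¹ • (splitMat m * (g.g1 ζ : Mat r)) := by
      rw [formAtInfty_act_mul, mul_add, add_mul, mul_smul_comm, smul_mul_assoc]
      simp only [Matrix.mul_assoc]
    _ = g.g1 ζ * connAtInfty m A ζ - matDeriv (fun u => (g.g1 u : Mat r)) ζ := by
      rw [hleft, g.powMat_mul_matDeriv_g0_inv hζ, connAtInfty, mul_sub, smul_sub, smul_smul,
        smul_smul, show (ζ ^ 2)⁻¹ * ζ = ζ⁻¹ by field_simp,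
        inv_mul_cancel₀ (pow_ne_zero 2 hζ), one_smul, smul_sub, mul_smul_comm]
      simp only [Matrix.mul_assoc]
      abel

theorem connAtInfty_act (g : BundleAut m) (A : ℂ → Mat r) {ζ : ℂ} (hζ : ζ ≠ 0) :
    connAtInfty m (g.act A) ζ = Ad (g.g1 ζ) (connAtInfty m A ζ) -
      matDeriv (fun u => (g.g1 u : Mat r)) ζ * (((g.g1 ζ)⁻¹ : GL (Fin r) ℂ) : Mat r) :=
  eq_Ad_sub_of_mul_eq (g.connAtInfty_act_mul A hζ)

end BundleAut

/-! ### The gauge action on logarithmic connections -/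

namespace BundleAut

variable {r k : ℕ} {m : Fin r → ℤ}

theorem isEntire_Ad (g : BundleAut m) {f : ℂ → Mat r} (hf : IsEntire f) :
    IsEntire fun w => Ad (g.g0 w) (f w) :=
  (g.holo0.mul hf).mul (IsEntire.inv g.holo0)

theorem isHolomorphicAtZero_Ad (g : BundleAut m) {f : ℂ → Mat r} (hf : IsHolomorphicAtZero f) :
    IsHolomorphicAtZero fun ζ => Ad (g.g1 ζ) (f ζ) :=
  (g.holo1.isHolomorphicAtZero.mul hf).mul (IsEntire.inv g.holo1).isHolomorphicAtZero

theorem isHolomorphicAtZero_matDeriv_mul_inv (g : BundleAut m) :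
    IsHolomorphicAtZero fun ζ =>
      matDeriv (fun u => (g.g1 u : Mat r)) ζ * (((g.g1 ζ)⁻¹ : GL (Fin r) ℂ) : Mat r) :=
  (g.holo1.matDeriv.mul (IsEntire.inv g.holo1)).isHolomorphicAtZero

theorem exists_act_eq_sum_add (g : BundleAut m) {z : Fin k → ℂ}
    {A : ℂ → Mat r} {R : Fin k → Mat r} {f₀ : ℂ → Mat r} (hf₀ : IsEntire f₀)
    (hA : ∀ w, w ∉ Set.range z → A w = ∑ i, (w - z i)⁻¹ • R i + f₀ w) :
    ∃ f : ℂ → Mat r, IsEntire f ∧ ∀ w, w ∉ Set.range z →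
      g.act A w = ∑ i, (w - z i)⁻¹ • Ad (g.g0 (z i)) (R i) + f w := by
  choose h hh he using fun i => (g.isEntire_Ad (isEntire_const (R i))).exists_smul_eq (z i)
  refine ⟨fun w => (∑ i, h i w) + (Ad (g.g0 w) (f₀ w) -
    matDeriv (fun u => (g.g0 u : Mat r)) w * (((g.g0 w)⁻¹ : GL (Fin r) ℂ) : Mat r)), ?_, ?_⟩
  · exact (IsEntire.sum _ hh).add ((g.isEntire_Ad hf₀).sub
      (g.holo0.matDeriv.mul (IsEntire.inv g.holo0)))
  · intro w hw
    have hpole : ∀ i, (w - z i)⁻¹ • Ad (g.g0 w) (R i) =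
        (w - z i)⁻¹ • Ad (g.g0 (z i)) (R i) + h i w :=
      fun i => he i w fun hwi => hw ⟨i, hwi.symm⟩
    rw [act, hA w hw, Ad_add, Ad_sum]
    simp only [Ad_smul, hpole, Finset.sum_add_distrib]
    abel

theorem exists_connAtInfty_act_eq_add (g : BundleAut m)
    {A : ℂ → Mat r} {R : Mat r} {f₁ : ℂ → Mat r} (hf₁ : IsHolomorphicAtZero f₁)
    (hA : ∀ᶠ ζ in 𝓝[≠] (0 : ℂ), connAtInfty m A ζ = ζ⁻¹ • R + f₁ ζ) :
    ∃ f : ℂ → Mat r, IsHolomorphicAtZero f ∧ ∀ᶠ ζ in 𝓝[≠] (0 : ℂ),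
      connAtInfty m (g.act A) ζ = ζ⁻¹ • Ad (g.g1 0) R + f ζ := by
  obtain ⟨h, hh, he⟩ :=
    (g.isHolomorphicAtZero_Ad (isHolomorphicAtZero_const R)).exists_smul_eq
  refine ⟨_, hh.add ((g.isHolomorphicAtZero_Ad hf₁).sub
    g.isHolomorphicAtZero_matDeriv_mul_inv), ?_⟩
  filter_upwards [hA, self_mem_nhdsWithin] with ζ hζ hζ0
  rw [g.connAtInfty_act A hζ0, hζ, Ad_add, Ad_smul, he ζ hζ0]
  abel

theorem isAdaptedConnection_act (g : BundleAut m) {z : Fin k → ℂ}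
    {α : Fin (k + 1) → Fin r → ℝ} {F : Fin (k + 1) → CompleteFlag r} {A : ℂ → Mat r}
    (hA : IsAdaptedConnection m z α F A) :
    IsAdaptedConnection m z α (g.actFlags z F) (g.act A) := by
  obtain ⟨R, ⟨f₀, hf₀, h0⟩, ⟨f₁, hf₁, h1⟩, hB⟩ := hA
  refine ⟨Fin.lastCases (motive := fun _ => Mat r) (Ad (g.g1 0) (R (Fin.last k)))
    (fun i => Ad (g.g0 (z i)) (R i.castSucc)), ?_, ?_, ?_⟩
  · simpa only [Fin.lastCases_castSucc] using g.exists_act_eq_sum_add hf₀ h0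
  · simpa only [Fin.lastCases_last] using g.exists_connAtInfty_act_eq_add hf₁ h1
  · intro i
    obtain ⟨B, hR, hF⟩ := hB i
    induction i using Fin.lastCases with
    | last =>
      refine ⟨g.g1 0 * B, ?_, ?_⟩
      · rw [Fin.lastCases_last, hR, Ad_mul]
      · rw [actFlags, Fin.lastCases_last, hF, act_flagOfFrame]
    | cast i =>
      refine ⟨g.g0 (z i) * B, ?_, ?_⟩
      · rw [Fin.lastCases_castSucc, hR, Ad_mul]
      · rw [actFlags, Fin.lastCases_castSucc, hF, act_flagOfFrame]

end BundleAut

/-! ### Fuchsian systems -/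

section Fuchsian

theorem tendsto_inv_mul_inv_sub (c : ℂ) :
    Tendsto (fun ζ : ℂ => ζ⁻¹ * (ζ⁻¹ - c)⁻¹) (𝓝[≠] 0) (𝓝 1) := by
  have hcont : ContinuousAt (fun ζ : ℂ => (1 - ζ * c)⁻¹) 0 := by fun_prop (disch := simp)
  have hlim : Tendsto (fun ζ : ℂ => (1 - ζ * c)⁻¹) (𝓝[≠] 0) (𝓝 1) := by
    simpa using hcont.tendsto.mono_left nhdsWithin_le_nhds
  refine hlim.congr' ?_
  filter_upwards [self_mem_nhdsWithin] with ζ (hζ : ζ ≠ 0)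
  rw [← mul_inv, mul_sub, mul_inv_cancel₀ hζ]

theorem tendsto_inv_smul_sum_poles {ι E : Type*} [Fintype ι] [AddCommMonoid E]
    [TopologicalSpace E] [ContinuousAdd E] [Module ℂ E] [ContinuousSMul ℂ E] (z : ι → ℂ)
    (R : ι → E) :
    Tendsto (fun ζ : ℂ => ζ⁻¹ • ∑ i, (ζ⁻¹ - z i)⁻¹ • R i) (𝓝[≠] 0) (𝓝 (∑ i, R i)) := by
  simp only [Finset.smul_sum, smul_smul]
  refine tendsto_finsetSum _ fun i _ => ?_
  simpa using (tendsto_inv_mul_inv_sub (z i)).smul_const (R i)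

variable {r k : ℕ} {A f : ℂ → Mat r} {D : Mat r}

theorem tendsto_smul_formAtInfty (hf : IsHolomorphicAtZero f)
    (hD : ∀ᶠ ζ in 𝓝[≠] (0 : ℂ), formAtInfty A ζ = ζ⁻¹ • D + f ζ) :
    Tendsto (fun ζ => ζ • formAtInfty A ζ) (𝓝[≠] 0) (𝓝 D) := by
  have hlim : Tendsto (fun ζ => D + ζ • f ζ) (𝓝[≠] 0) (𝓝 D) := by
    simpa using hf.smul.tendsto.const_add D
  refine hlim.congr' ?_
  filter_upwards [hD, self_mem_nhdsWithin] with ζ h (hζ : ζ ≠ 0)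
  rw [h, smul_add, smul_inv_smul₀ hζ]

theorem tendsto_inv_smul_of_formAtInfty
    (hD : Tendsto (fun ζ => ζ • formAtInfty A ζ) (𝓝[≠] 0) (𝓝 D)) :
    Tendsto (fun ζ => ζ⁻¹ • A ζ⁻¹) (𝓝[≠] 0) (𝓝 (-D)) := by
  refine hD.neg.congr' ?_
  filter_upwards [self_mem_nhdsWithin] with ζ (hζ : ζ ≠ 0)
  rw [formAtInfty, smul_smul, ← neg_smul, show -(ζ * -(ζ ^ 2)⁻¹) = ζ⁻¹ by field_simp]

theorem eventually_inv_notMem_range (z : Fin k → ℂ) :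
    ∀ᶠ ζ in 𝓝[≠] (0 : ℂ), ζ⁻¹ ∉ Set.range z :=
  tendsto_inv₀_nhdsNE_zero.eventually (Bornology.isBounded_def.1 (Set.finite_range z).isBounded)

theorem isFuchsianSystem_of_formAtInfty {z : Fin k → ℂ} {R : Fin k → Mat r}
    {f₀ : ℂ → Mat r} (hf₀ : IsEntire f₀)
    (hA : ∀ w, w ∉ Set.range z → A w = ∑ i, (w - z i)⁻¹ • R i + f₀ w)
    (hf : IsHolomorphicAtZero f)
    (hD : ∀ᶠ ζ in 𝓝[≠] (0 : ℂ), formAtInfty A ζ = ζ⁻¹ • D + f ζ) :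
    IsFuchsianSystem z A R ∧ ∑ i, R i = -D := by
  have hpoles := tendsto_inv_smul_sum_poles z R
  have hrem : Tendsto (fun ζ => ζ⁻¹ • f₀ ζ⁻¹) (𝓝[≠] 0) (𝓝 (-D - ∑ i, R i)) := by
    refine ((tendsto_inv_smul_of_formAtInfty (tendsto_smul_formAtInfty hf hD)).sub
      hpoles).congr' ?_
    filter_upwards [eventually_inv_notMem_range z] with ζ hζ
    rw [hA _ hζ, smul_add, add_sub_cancel_left]
  have hzero : ∀ w, f₀ w = 0 := by
    refine hf₀.eq_const_of_tendsto_inv ?_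
    have hid : Tendsto (fun ζ : ℂ => ζ) (𝓝[≠] 0) (𝓝 0) :=
      tendsto_id.mono_left nhdsWithin_le_nhds
    have hlim : Tendsto (fun ζ => ζ • ζ⁻¹ • f₀ ζ⁻¹) (𝓝[≠] 0) (𝓝 0) := by
      simpa using hid.smul hrem
    refine hlim.congr' ?_
    filter_upwards [self_mem_nhdsWithin] with ζ (hζ : ζ ≠ 0)
    rw [smul_inv_smul₀ hζ]
  refine ⟨fun w hw => by rw [hA w hw, hzero, add_zero], ?_⟩
  simp only [hzero, smul_zero] at hrem
  exact (sub_eq_zero.1 (tendsto_nhds_unique hrem tendsto_const_nhds)).symm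

end Fuchsian

/-! ### Monodromy of gauge equivalent connections -/

theorem BundleAut.isMonodromyRep_act {r k : ℕ} {m : Fin r → ℤ} (g : BundleAut m) {z : Fin k → ℂ}
    {A : ℂ → Mat r} {x₀ : Punctured z} {ρ : FundamentalGroup (Punctured z) x₀ →* GL (Fin r) ℂ}
    (hρ : IsMonodromyRep z A x₀ ρ) :
    IsMonodromyRep z (g.act A) x₀ ((MulAut.conj (g.g0 x₀)).toMonoidHom.comp ρ) := by
  intro γ
  obtain ⟨Y, hY, hY0, hY1⟩ := hρ γ
  set C := (((g.g0 x₀)⁻¹ : GL (Fin r) ℂ) : Mat r) with hC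
  refine ⟨fun t => g.g0 (γ t : Punctured z) * Y t * C, fun t => ?_, ?_, ?_⟩
  · obtain ⟨Φ, hΦ, hYΦ⟩ := hY t
    refine ⟨fun u => g.g0 u * Φ u * C, ?_, hYΦ.mono fun s hs => by simp only [hs]⟩
    filter_upwards [hΦ] with w (hw : HasMatDerivAt Φ (-(A w * Φ w)) w)
    have hderiv := ((g.holo0.hasMatDerivAt w).mul hw).mul_const C
    have hsol : (matDeriv (fun u => (g.g0 u : Mat r)) w * Φ w +
        (g.g0 w : Mat r) * -(A w * Φ w)) * C = -(g.act A w * (g.g0 w * Φ w * C)) := by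
      rw [← Matrix.mul_assoc, ← Matrix.mul_assoc, g.act_mul_g0]
      simp only [sub_mul, add_mul, mul_neg, neg_mul, Matrix.mul_assoc]
      abel
    rwa [hsol] at hderiv
  · simp only [hY0, γ.source, mul_one, hC]
    exact Units.mul_inv _
  · simp only [hY1, γ.target, hC]
    rfl

theorem IsAdaptedConnection.analyticAt {r k : ℕ} {m : Fin r → ℤ} {z : Fin k → ℂ}
    {α : Fin (k + 1) → Fin r → ℝ} {F : Fin (k + 1) → CompleteFlag r} {A : ℂ → Mat r}
    (hA : IsAdaptedConnection m z α F A) (c : Punctured z) (a b : Fin r) :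
    AnalyticAt ℂ (fun w => A w a b) c := by
  obtain ⟨R, ⟨f₀, hf₀, h0⟩, -, -⟩ := hA
  have hev : (fun w => (∑ i : Fin k, (w - z i)⁻¹ • R i.castSucc + f₀ w) a b)
      =ᶠ[𝓝 (c : ℂ)] fun w => A w a b := by
    filter_upwards [(Set.finite_range z).isClosed.isOpen_compl.mem_nhds c.2] with w hw
    rw [h0 w hw]
  refine AnalyticAt.congr ?_ hev
  simp only [Matrix.add_apply, Matrix.sum_apply, Matrix.smul_apply, smul_eq_mul]
  refine (Finset.analyticAt_fun_sum _ fun i _ => ?_).add ((hf₀ a b).analyticAt _)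
  have hne : (c : ℂ) - z i ≠ 0 := sub_ne_zero.2 fun h => c.2 ⟨i, h.symm⟩
  exact ((analyticAt_id.sub analyticAt_const).inv hne).mul analyticAt_const

/-! ### Uniqueness of the normalizing gauge -/

/-- No two entries of `a` differ by an integer, i.e. the residue with eigenvalues `a` has no
resonances. -/
def IsNonresonant {ι : Type*} (a : ι → ℝ) : Prop :=
  ∀ ⦃i j⦄, i ≠ j → ∀ n : ℤ, a i - a j ≠ n

theorem isNonresonant_of_injective {ι : Type*} {a : ι → ℝ} (ha : Function.Injective a)
    (ha01 : ∀ j, 0 ≤ a j ∧ a j < 1) : IsNonresonant a := by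
  intro i j hij n h
  have hlt : n < 1 := by exact_mod_cast (by linarith [(ha01 i).2, (ha01 j).1] : (n : ℝ) < 1)
  have hgt : -1 < n := by exact_mod_cast (by linarith [(ha01 i).1, (ha01 j).2] : (-1 : ℝ) < n)
  obtain rfl : n = 0 := by lia
  exact hij (ha (by simpa [sub_eq_zero] using h))

theorem IsNonresonant.int_add_sub_ne_zero {ι : Type*} {a : ι → ℝ} (ha : IsNonresonant a)
    {i j : ι} (hij : i ≠ j) (n : ℤ) : (n : ℂ) + a i - a j ≠ 0 := by
  intro h
  have hreal : (n : ℝ) + a i - a j = 0 := by exact_mod_cast h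
  exact ha hij (-n) (by push_cast; linarith)

theorem exists_nat_forall_sub_le {ι : Type*} [Finite ι] (m : ι → ℤ) :
    ∃ d : ℕ, ∀ i j, m i - m j ≤ d := by
  obtain ⟨B, hB⟩ := (Set.finite_range fun p : ι × ι => m p.1 - m p.2).bddAbove
  exact ⟨B.toNat, fun i j => (hB ⟨(i, j), rfl⟩).trans (Int.self_le_toNat B)⟩

theorem exists_eq_of_leading_coeff_eq_zero {r : ℕ} {H : ℂ → Mat r}
    (hlead : ∀ (n : ℕ) (G : ℂ → Mat r), IsHolomorphicAtZero G →
      (∀ᶠ ζ in 𝓝[≠] (0 : ℂ), ζ ^ (n + 1) • H ζ = G ζ) → G 0 = 0) (n : ℕ) {G : ℂ → Mat r}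
    (hG : IsHolomorphicAtZero G) (hH : ∀ᶠ ζ in 𝓝[≠] (0 : ℂ), ζ ^ n • H ζ = G ζ) :
    ∃ G : ℂ → Mat r, IsHolomorphicAtZero G ∧ ∀ᶠ ζ in 𝓝[≠] (0 : ℂ), H ζ = G ζ := by
  induction n generalizing G with
  | zero => exact ⟨G, hG, by simpa using hH⟩
  | succ n ih =>
    obtain ⟨G', hG', hdiv⟩ := hG.exists_smul_eq
    refine ih hG' ?_
    filter_upwards [hH, self_mem_nhdsWithin] with ζ h (hζ : ζ ≠ 0)
    have := hdiv ζ hζ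
    rwa [← h, hlead n G hG hH, smul_zero, zero_add, pow_succ', mul_smul,
      inv_smul_smul₀ hζ] at this

namespace BundleAut

variable {r : ℕ} {m : Fin r → ℤ}

theorem exists_pow_smul_g0_inv_eq (h : BundleAut m) : ∃ (n : ℕ) (G : ℂ → Mat r),
    IsHolomorphicAtZero G ∧ ∀ᶠ ζ in 𝓝[≠] (0 : ℂ), ζ ^ n • (h.g0 ζ⁻¹ : Mat r) = G ζ := by
  obtain ⟨d, hd⟩ := exists_nat_forall_sub_le m
  refine ⟨d, fun ζ => Matrix.of fun i j =>
    ζ ^ ((d : ℤ) + (m j - m i)).toNat * (h.g1 ζ : Mat r) i j, fun i j => ?_, ?_⟩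
  · exact (analyticAt_id.pow _).mul (h.holo1.isHolomorphicAtZero i j)
  · filter_upwards [self_mem_nhdsWithin] with ζ (hζ : ζ ≠ 0)
    ext i j
    have hnonneg : 0 ≤ (d : ℤ) + (m j - m i) := by linarith [hd i j]
    rw [Matrix.smul_apply, h.g0_inv_eq hζ, powMat_neg_conj_apply m hζ, Matrix.of_apply,
      smul_eq_mul, ← mul_assoc, ← zpow_natCast, ← zpow_natCast, ← zpow_add₀ hζ,
      Int.toNat_of_nonneg hnonneg]

theorem hasMatDerivAt_g0_inv (h : BundleAut m) (A : ℂ → Mat r) {ζ : ℂ} (hζ : ζ ≠ 0) :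
    HasMatDerivAt (fun u => (h.g0 u⁻¹ : Mat r))
      (h.g0 ζ⁻¹ * formAtInfty A ζ - formAtInfty (h.act A) ζ * h.g0 ζ⁻¹) ζ := by
  intro i j
  rw [h.formAtInfty_act_mul, sub_add_cancel_left, Matrix.neg_apply, Matrix.smul_apply,
    smul_eq_mul, mul_comm, ← mul_neg]
  exact (h.holo0.hasMatDerivAt ζ⁻¹ i j).comp (h₂ := fun u => (h.g0 u : Mat r) i j) ζ
    (hasDerivAt_inv hζ)

theorem eventually_smul_matDeriv_eq (h : BundleAut m) (A : ℂ → Mat r) {n : ℕ} {G : ℂ → Mat r}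
    (hH : ∀ᶠ ζ in 𝓝[≠] (0 : ℂ), ζ ^ n • (h.g0 ζ⁻¹ : Mat r) = G ζ) :
    ∀ᶠ ζ in 𝓝[≠] (0 : ℂ), ζ • matDeriv G ζ = (n : ℂ) • G ζ + G ζ * (ζ • formAtInfty A ζ) -
      (ζ • formAtInfty (h.act A) ζ) * G ζ := by
  have hH' : ∀ᶠ ζ in 𝓝[≠] (0 : ℂ), ∀ᶠ u in 𝓝 ζ, u ^ n • (h.g0 u⁻¹ : Mat r) = G u := by
    filter_upwards [eventually_eventually_nhdsWithin.2 hH, self_mem_nhdsWithin] with ζ hev hζ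
    rwa [isOpen_compl_singleton.nhdsWithin_eq hζ] at hev
  filter_upwards [hH', self_mem_nhdsWithin] with ζ hev (hζ : ζ ≠ 0)
  have hderiv : HasMatDerivAt G _ ζ := fun a b =>
    (HasMatDerivAt.smul (hasDerivAt_pow n ζ) (h.hasMatDerivAt_g0_inv A hζ)
      a b).congr_of_eventuallyEq (hev.mono fun u hu => congrFun₂ hu.symm a b)
  have hpow : ζ * (n * ζ ^ (n - 1)) = n * ζ ^ n := by
    rcases n with _ | n
    · simp
    · rw [Nat.add_sub_cancel, pow_succ]; ring
  rw [hderiv.matDeriv, ← hev.self_of_nhds, smul_add, smul_smul, hpow]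
  simp only [smul_sub, smul_mul_assoc, mul_smul_comm, smul_smul, mul_comm ζ]
  abel

/-- To leading order at infinity, `h` is an eigenvector of the adjoint action of the residues: this
is the limit of the differential equation for `ζ ^ n • h.g0 ζ⁻¹`. -/
theorem leading_coeff_eq (h : BundleAut m) {A : ℂ → Mat r} {D D' : Mat r}
    (hA : Tendsto (fun ζ => ζ • formAtInfty A ζ) (𝓝[≠] 0) (𝓝 D))
    (hA' : Tendsto (fun ζ => ζ • formAtInfty (h.act A) ζ) (𝓝[≠] 0) (𝓝 D'))
    {n : ℕ} {G : ℂ → Mat r} (hG : IsHolomorphicAtZero G)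
    (hH : ∀ᶠ ζ in 𝓝[≠] (0 : ℂ), ζ ^ n • (h.g0 ζ⁻¹ : Mat r) = G ζ) :
    (n : ℂ) • G 0 + G 0 * D - D' * G 0 = 0 := by
  have hleft : Tendsto (fun ζ => ζ • matDeriv G ζ) (𝓝[≠] 0) (𝓝 0) := by
    simpa using hG.matDeriv.smul.tendsto
  have hright := ((hG.tendsto.const_smul (n : ℂ)).add (hG.tendsto.mul hA)).sub
    (hA'.mul hG.tendsto)
  exact tendsto_nhds_unique (hright.congr' (EventuallyEq.symm
    (h.eventually_smul_matDeriv_eq A hH))) hleft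

variable {a : Fin r → ℝ} {σ : Equiv.Perm (Fin r)}

theorem leading_coeff_apply_eq_zero (h : BundleAut m) {A : ℂ → Mat r} (ha : IsNonresonant a)
    (hA : IsNormalizedAtInfty m a σ A) (hA' : IsNormalizedAtInfty m a σ (h.act A))
    {n : ℕ} {G : ℂ → Mat r} (hG : IsHolomorphicAtZero G)
    (hH : ∀ᶠ ζ in 𝓝[≠] (0 : ℂ), ζ ^ n • (h.g0 ζ⁻¹ : Mat r) = G ζ) {i j : Fin r}
    (hij : n ≠ 0 ∨ i ≠ j) : G 0 i j = 0 := by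
  obtain ⟨f, hf, hfA⟩ := hA
  obtain ⟨f', hf', hfA'⟩ := hA'
  have hlead := congrFun₂ (h.leading_coeff_eq (tendsto_smul_formAtInfty hf hfA)
    (tendsto_smul_formAtInfty hf' hfA') hG hH) i j
  simp only [normalResidue_eq, Matrix.sub_apply, Matrix.add_apply, Matrix.smul_apply,
    Matrix.mul_diagonal, Matrix.diagonal_mul, Matrix.zero_apply, smul_eq_mul] at hlead
  have heigen : ((n : ℂ) + (m j + a (σ j)) - (m i + a (σ i))) * G 0 i j = 0 := by
    linear_combination hlead
  refine (mul_eq_zero.1 heigen).resolve_left ?_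
  by_cases h_eq : i = j
  · simpa [h_eq] using hij
  · have hne := ha.int_add_sub_ne_zero (fun e => h_eq (σ.injective e).symm) (n + m j - m i)
    push_cast at hne
    exact fun e => hne (by linear_combination e)

theorem exists_eq_diagonal_of_isNormalizedAtInfty (h : BundleAut m) {A : ℂ → Mat r}
    (ha : IsNonresonant a) (hA : IsNormalizedAtInfty m a σ A)
    (hA' : IsNormalizedAtInfty m a σ (h.act A)) :
    ∃ d : Fin r → ℂ, (∀ j, d j ≠ 0) ∧ ∀ w, (h.g0 w : Mat r) = Matrix.diagonal d := by
  obtain ⟨n, G₀, hG₀, hH₀⟩ := h.exists_pow_smul_g0_inv_eq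
  obtain ⟨G, hG, hH⟩ := exists_eq_of_leading_coeff_eq_zero (fun n G hG hH => Matrix.ext fun _ _ =>
    h.leading_coeff_apply_eq_zero ha hA hA' hG hH (Or.inl n.succ_ne_zero)) n hG₀ hH₀
  have hconst : ∀ w, (h.g0 w : Mat r) = G 0 :=
    h.holo0.eq_const_of_tendsto_inv (hG.tendsto.congr' (EventuallyEq.symm hH))
  have hdiag : G 0 = Matrix.diagonal fun j => G 0 j j := by
    refine (Matrix.isDiag_iff_diagonal_diag _).1 (fun i j hij => ?_) |>.symm
    exact h.leading_coeff_apply_eq_zero ha hA hA' (n := 0) hG (by simpa using hH) (Or.inr hij)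
  refine ⟨fun j => G 0 j j, fun j => ?_, fun w => by rw [hconst, ← hdiag]⟩
  have hu := (h.g0 0).isUnit
  rw [hconst, hdiag, Matrix.isUnit_diagonal, Pi.isUnit_iff] at hu
  exact (hu j).ne_zero

theorem exists_diagonal_mul_eq (g g' : BundleAut m) {A : ℂ → Mat r} (ha : IsNonresonant a)
    (hA : IsNormalizedAtInfty m a σ (g.act A)) (hA' : IsNormalizedAtInfty m a σ (g'.act A)) :
    ∃ d : Fin r → ℂ, (∀ j, d j ≠ 0) ∧
      ∀ w, (g'.g0 w : Mat r) = Matrix.diagonal d * (g.g0 w : Mat r) := by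
  have hact : (g' * g⁻¹).act (g.act A) = g'.act A := by rw [← mul_act, inv_mul_cancel_right]
  obtain ⟨d, hd, hd'⟩ :=
    (g' * g⁻¹).exists_eq_diagonal_of_isNormalizedAtInfty ha hA (hact ▸ hA')
  refine ⟨d, hd, fun w => ?_⟩
  rw [← hd' w]
  exact congrArg (fun h : BundleAut m => (h.g0 w : Mat r)) (inv_mul_cancel_right g' g).symm

end BundleAut

/-! ### Relative position of a flag and the splitting -/

section Parabolic

variable {r : ℕ} {m : Fin r → ℤ} {p q : GL (Fin r) ℂ}

theorem isParabolic_iff_blockTriangular :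
    IsParabolic m p ↔ (p : Mat r).BlockTriangular fun j => OrderDual.toDual (m j) :=
  ⟨fun h _ _ hij => h _ _ hij, fun h _ _ hij => h hij⟩

theorem isParabolic_one : IsParabolic m 1 :=
  isParabolic_iff_blockTriangular.2 Matrix.blockTriangular_one

theorem IsParabolic.mul (hp : IsParabolic m p) (hq : IsParabolic m q) : IsParabolic m (p * q) := by
  rw [isParabolic_iff_blockTriangular] at *
  exact hp.mul hq

theorem blockTriangular_units_inv {β : Type*} [LinearOrder β] {b : Fin r → β}
    (hp : (p : Mat r).BlockTriangular b) :
    ((p⁻¹ : GL (Fin r) ℂ) : Mat r).BlockTriangular b := by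
  let _ : Invertible (p : Mat r) := p.isUnit.invertible
  rw [Matrix.coe_units_inv]
  exact Matrix.blockTriangular_inv_of_blockTriangular hp

theorem IsParabolic.inv (hp : IsParabolic m p) : IsParabolic m p⁻¹ :=
  isParabolic_iff_blockTriangular.2
    (blockTriangular_units_inv (isParabolic_iff_blockTriangular.1 hp))

/-- The elementary matrix `1 + c E_ij` as an element of the general linear group. -/
noncomputable def transvectionGL (i j : Fin r) (h : i ≠ j) (c : ℂ) : GL (Fin r) ℂ where
  val := Matrix.transvection i j c
  inv := Matrix.transvection i j (-c)
  val_inv := by rw [Matrix.transvection_mul_transvection_same _ _ h]; simp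
  inv_val := by rw [Matrix.transvection_mul_transvection_same _ _ h]; simp

theorem isParabolic_transvectionGL {i j : Fin r} (h : i ≠ j) (hm : m j ≤ m i) (c : ℂ) :
    IsParabolic m (transvectionGL i j h c) :=
  isParabolic_iff_blockTriangular.2 (Matrix.blockTriangular_transvection
    (b := fun j => OrderDual.toDual (m j)) (OrderDual.toDual_le_toDual.2 hm) c)

end Parabolic

section LastIndex

variable {r : ℕ} {K : Type*}

open Classical in
/-- The position of the last nonzero entry of a vector; its value at `0` is irrelevant. -/
noncomputable def lastIndex [Zero K] (v : Fin r → K) : ℕ :=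
  (Finset.univ.filter fun l => v l ≠ 0).sup Fin.val

theorem exists_apply_ne_zero_and_eq_lastIndex [Zero K] {v : Fin r → K} (hv : v ≠ 0) :
    ∃ l, v l ≠ 0 ∧ l = lastIndex v := by
  classical
  obtain ⟨l, hl⟩ := Function.ne_iff.1 hv
  obtain ⟨i, hi, he⟩ := Finset.exists_mem_eq_sup (Finset.univ.filter fun l => v l ≠ 0)
    ⟨l, by simpa using hl⟩ Fin.val
  exact ⟨i, by simpa using hi, by rw [lastIndex, ← he]⟩

theorem apply_eq_zero_of_lastIndex_lt [Zero K] {v : Fin r → K} {l : Fin r}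
    (h : lastIndex v < l) : v l = 0 := by
  classical
  by_contra hl
  exact h.not_ge (Finset.le_sup (f := Fin.val) (by simpa using hl))

theorem exists_lastIndex_add_smul_lt [Field K] {v w : Fin r → K} (h : lastIndex v = lastIndex w)
    (hw : w ≠ 0) (hvw : ∀ t : K, v + t • w ≠ 0) : ∃ t : K, lastIndex (v + t • w) < lastIndex v := by
  obtain ⟨l, hl, hlw⟩ := exists_apply_ne_zero_and_eq_lastIndex hw
  refine ⟨-(v l / w l), ?_⟩
  obtain ⟨s, hs, hs_last⟩ := exists_apply_ne_zero_and_eq_lastIndex (hvw (-(v l / w l)))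
  rw [← hs_last]
  by_contra! hle
  refine hs ?_
  rcases hle.eq_or_lt with heq | hlt
  · obtain rfl : s = l := Fin.ext (by rw [← heq, h, hlw])
    simp [hl]
  · simp [apply_eq_zero_of_lastIndex_lt hlt, apply_eq_zero_of_lastIndex_lt (h ▸ hlt)]

end LastIndex

section BruhatCells

variable {r : ℕ} {m : Fin r → ℤ}

theorem GL_row_ne_zero (g : GL (Fin r) ℂ) (i : Fin r) : (g : Mat r) i ≠ 0 :=
  (Matrix.linearIndependent_rows_of_isUnit g.isUnit).ne_zero i

theorem exists_isParabolic_sum_lastIndex_lt (m : Fin r → ℤ) {C : GL (Fin r) ℂ}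
    (hC : ¬ Function.Injective fun i => lastIndex ((C : Mat r) i)) :
    ∃ q : GL (Fin r) ℂ, IsParabolic m q ∧
      ∑ i, lastIndex (((q * C : GL (Fin r) ℂ) : Mat r) i) < ∑ i, lastIndex ((C : Mat r) i) := by
  obtain ⟨i, j, hij, hne⟩ : ∃ i j, lastIndex ((C : Mat r) i) = lastIndex ((C : Mat r) j) ∧ i ≠ j :=
    by simpa [Function.Injective] using hC
  wlog hm : m j ≤ m i generalizing i j
  · exact this j i hij.symm hne.symm (le_of_not_ge hm)
  have hrow : ∀ t : ℂ, ((transvectionGL i j hne t * C : GL (Fin r) ℂ) : Mat r) i =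
      (C : Mat r) i + t • (C : Mat r) j := fun t =>
    funext fun b => Matrix.transvection_mul_apply_same i j b t C
  obtain ⟨t, ht⟩ := exists_lastIndex_add_smul_lt hij (GL_row_ne_zero C j)
    fun t => hrow t ▸ GL_row_ne_zero _ i
  refine ⟨transvectionGL i j hne t, isParabolic_transvectionGL hne hm t,
    Finset.sum_lt_sum (fun a _ => ?_) ⟨i, Finset.mem_univ _, by rwa [hrow]⟩⟩
  by_cases ha : a = i
  · rw [ha, hrow]
    exact ht.le
  · exact (congrArg lastIndex (funext fun b =>
      Matrix.transvection_mul_apply_of_ne i j a b ha t (C : Mat r))).le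

theorem exists_isParabolic_injective_lastIndex (m : Fin r → ℤ) (B : GL (Fin r) ℂ) :
    ∃ p : GL (Fin r) ℂ, IsParabolic m p ∧
      Function.Injective fun i => lastIndex (((p * B : GL (Fin r) ℂ) : Mat r) i) := by
  induction hμ : ∑ i, lastIndex ((B : Mat r) i) using Nat.strong_induction_on generalizing B with
  | _ n ih =>
    by_cases hB : Function.Injective fun i => lastIndex ((B : Mat r) i)
    · exact ⟨1, isParabolic_one, by rwa [one_mul]⟩
    · obtain ⟨q, hq, hlt⟩ := exists_isParabolic_sum_lastIndex_lt m hB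
      obtain ⟨p, hp, hinj⟩ := ih _ (hμ ▸ hlt) (q * B) rfl
      exact ⟨p * q, hp.mul hq, by rwa [mul_assoc]⟩

theorem exists_isLowerTriangular_of_injective_lastIndex {C : GL (Fin r) ℂ}
    (hC : Function.Injective fun i => lastIndex ((C : Mat r) i)) :
    ∃ σ : Equiv.Perm (Fin r),
      (((permGL σ)⁻¹ * C : GL (Fin r) ℂ) : Mat r).IsLowerTriangular := by
  choose c _ hc using fun i => exists_apply_ne_zero_and_eq_lastIndex (GL_row_ne_zero C i)
  have hc_inj : Function.Injective c := fun i j hij =>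
    hC (by simpa only [hc] using congrArg Fin.val hij)
  let σ : Equiv.Perm (Fin r) := Equiv.ofBijective c (Finite.injective_iff_bijective.1 hc_inj)
  refine ⟨σ, fun a l (hal : a < l) => ?_⟩
  have hperm : (((permGL σ)⁻¹ * C : GL (Fin r) ℂ) : Mat r) = (C : Mat r).submatrix σ.symm id :=
    PEquiv.toMatrix_toPEquiv_mul σ.symm (C : Mat r)
  rw [hperm]
  refine apply_eq_zero_of_lastIndex_lt (v := (C : Mat r) (σ.symm a)) ?_
  rwa [← hc, show c (σ.symm a) = a from σ.apply_symm_apply a]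

theorem flagOfFrame_mul_of_isLowerTriangular (C : GL (Fin r) ℂ) {U : GL (Fin r) ℂ}
    (hU : (U : Mat r).IsLowerTriangular) : flagOfFrame (C * U) = flagOfFrame C := by
  ext1
  funext j
  refine Submodule.eq_of_le_of_finrank_eq (Submodule.span_le.2 ?_)
    (((flagOfFrame (C * U)).finrank_eq j).trans ((flagOfFrame C).finrank_eq j).symm)
  rintro _ ⟨l, hl : j ≤ l, rfl⟩
  have hcol : ((C * U : GL (Fin r) ℂ) : Mat r).col l =
      ∑ i, (U : Mat r) i l • (C : Mat r).col i := by
    ext a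
    simp [Matrix.mul_apply, mul_comm]
  change ((C * U : GL (Fin r) ℂ) : Mat r).col l ∈ (flagOfFrame C).V j
  rw [hcol]
  refine Submodule.sum_mem _ fun i _ => ?_
  rcases lt_or_ge i l with hil | hil
  · rw [hU hil, zero_smul]
    exact Submodule.zero_mem _
  · exact Submodule.smul_mem _ _ (Submodule.subset_span ⟨i, hl.trans hil, rfl⟩)

theorem isLowerTriangular_of_flagOfFrame_eq {B C : GL (Fin r) ℂ}
    (h : flagOfFrame B = flagOfFrame C) :
    ((C⁻¹ * B : GL (Fin r) ℂ) : Mat r).IsLowerTriangular := by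
  intro l j (hlj : l < j)
  have hmem : (B : Mat r).col j ∈ (flagOfFrame C).V j := by
    rw [← h]
    exact Submodule.subset_span ⟨j, Set.self_mem_Ici, rfl⟩
  have hker : (flagOfFrame C).V j ≤ LinearMap.ker
      ((LinearMap.proj l).comp (Matrix.mulVecLin ((C⁻¹ : GL (Fin r) ℂ) : Mat r))) := by
    refine Submodule.span_le.2 ?_
    rintro _ ⟨i, hi : j ≤ i, rfl⟩
    change (((C⁻¹ : GL (Fin r) ℂ) : Mat r) * (C : Mat r)) l i = 0
    rw [Units.inv_mul, Matrix.one_apply_ne (hlj.trans_le hi).ne]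
  exact hker hmem

theorem exists_inCell (m : Fin r → ℤ) (B : GL (Fin r) ℂ) :
    ∃ σ : Equiv.Perm (Fin r), InCell m σ (flagOfFrame B) := by
  obtain ⟨p, hp, hinj⟩ := exists_isParabolic_injective_lastIndex m B
  obtain ⟨σ, hσ⟩ := exists_isLowerTriangular_of_injective_lastIndex hinj
  refine ⟨σ, p⁻¹, hp.inv, ?_⟩
  rw [← flagOfFrame_mul_of_isLowerTriangular (p⁻¹ * permGL σ) hσ, mul_assoc,
    mul_inv_cancel_left, inv_mul_cancel_left]

end BruhatCells

/-! ### Taylor coefficients -/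

section TaylorCoefficients

/-- The `n`-th Taylor coefficient at `0` of a function `f`, obtained by iterating
`f ↦ (f - f 0) / ζ`. -/
noncomputable def taylorCoeff (f : ℂ → ℂ) : ℕ → ℂ
  | 0 => f 0
  | n + 1 => taylorCoeff (dslope f 0) n

variable {f g : ℂ → ℂ}

theorem dslope_eq_of_eq_add_mul {F : ℂ → ℂ} {a : ℂ} (hF : ContinuousAt F 0)
    (h : ∀ w, f w = a + w * F w) : dslope f 0 = F := by
  have hne : ∀ w, w ≠ 0 → dslope f 0 w = F w := fun w hw => by
    simp [dslope_of_ne _ hw, slope_def_field, h, hw]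
  funext w
  rcases eq_or_ne w 0 with rfl | hw
  · rw [dslope_same]
    refine HasDerivAt.deriv (hasDerivAt_iff_tendsto_slope.2 ?_)
    refine (hF.tendsto.mono_left nhdsWithin_le_nhds).congr' ?_
    filter_upwards [self_mem_nhdsWithin] with u (hu : u ≠ 0)
    rw [← hne u hu, dslope_of_ne _ hu]
  · exact hne w hw

theorem taylorCoeff_add (hf : AnalyticAt ℂ f 0) (hg : AnalyticAt ℂ g 0) (n : ℕ) :
    taylorCoeff (fun w => f w + g w) n = taylorCoeff f n + taylorCoeff g n := by
  induction n generalizing f g with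
  | zero => rfl
  | succ n ih =>
    have hf' := analyticAt_dslope hf
    have hg' := analyticAt_dslope hg
    have hslope : dslope (fun w => f w + g w) 0 = fun w => dslope f 0 w + dslope g 0 w :=
      dslope_eq_of_eq_add_mul (a := f 0 + g 0) (hf'.add hg').continuousAt fun w => by
        rw [eq_add_mul_dslope f w, eq_add_mul_dslope g w]
        ring
    simp only [taylorCoeff, hslope, ih hf' hg']

theorem taylorCoeff_const_mul (c : ℂ) (hf : AnalyticAt ℂ f 0) (n : ℕ) :
    taylorCoeff (fun w => c * f w) n = c * taylorCoeff f n := by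
  induction n generalizing f with
  | zero => rfl
  | succ n ih =>
    have hf' := analyticAt_dslope hf
    have hslope : dslope (fun w => c * f w) 0 = fun w => c * dslope f 0 w :=
      dslope_eq_of_eq_add_mul (a := c * f 0) (analyticAt_const.mul hf').continuousAt fun w => by
        rw [eq_add_mul_dslope f w]
        ring
    simp only [taylorCoeff, hslope, ih hf']

theorem taylorCoeff_sub (hf : AnalyticAt ℂ f 0) (hg : AnalyticAt ℂ g 0) (n : ℕ) :
    taylorCoeff (fun w => f w - g w) n = taylorCoeff f n - taylorCoeff g n := by
  have hsub : (fun w => f w - g w) = fun w => f w + -1 * g w := by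
    funext w
    ring
  rw [hsub, taylorCoeff_add hf (analyticAt_const.fun_mul hg), taylorCoeff_const_mul _ hg]
  ring

theorem taylorCoeff_zero (n : ℕ) : taylorCoeff (fun _ => 0) n = 0 := by
  simpa using taylorCoeff_const_mul 0 (analyticAt_const (v := (0 : ℂ)) (x := 0)) n

theorem taylorCoeff_sum {ι : Type*} (s : Finset ι) {f : ι → ℂ → ℂ}
    (hf : ∀ i, AnalyticAt ℂ (f i) 0) (n : ℕ) :
    taylorCoeff (fun w => ∑ i ∈ s, f i w) n = ∑ i ∈ s, taylorCoeff (f i) n := by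
  classical
  induction s using Finset.induction_on with
  | empty => simpa using taylorCoeff_zero n
  | insert i s hi ih =>
    simp only [Finset.sum_insert hi]
    rw [taylorCoeff_add (hf i) (s.analyticAt_fun_sum fun i _ => hf i), ih]

theorem taylorCoeff_mul (hf : AnalyticAt ℂ f 0) (hg : AnalyticAt ℂ g 0) (n : ℕ) :
    taylorCoeff (fun w => f w * g w) n =
      ∑ p ∈ Finset.HasAntidiagonal.antidiagonal n, taylorCoeff f p.1 * taylorCoeff g p.2 := by
  induction n generalizing f with
  | zero => simp [taylorCoeff]
  | succ n ih =>
    have hf' := analyticAt_dslope hf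
    have hg' := analyticAt_dslope hg
    have hslope : dslope (fun w => f w * g w) 0 =
        fun w => f 0 * dslope g 0 w + dslope f 0 w * g w :=
      dslope_eq_of_eq_add_mul (a := f 0 * g 0)
        ((analyticAt_const.mul hg').add (hf'.mul hg)).continuousAt fun w => by
          linear_combination g w * eq_add_mul_dslope f w + f 0 * eq_add_mul_dslope g w
    rw [taylorCoeff, hslope, taylorCoeff_add (analyticAt_const.fun_mul hg') (hf'.fun_mul hg),
      taylorCoeff_const_mul _ hg', ih hf', Finset.Nat.sum_antidiagonal_succ]
    rfl

theorem taylorCoeff_const_mul_pow (c : ℂ) (e n : ℕ) :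
    taylorCoeff (fun w => c * w ^ e) n = if n = e then c else 0 := by
  induction e generalizing n with
  | zero =>
    rcases n with _ | n
    · simp [taylorCoeff]
    · have hslope : dslope (fun w : ℂ => c * w ^ 0) 0 = fun _ => 0 :=
        dslope_eq_of_eq_add_mul (a := c) continuousAt_const fun w => by simp
      rw [taylorCoeff, hslope, taylorCoeff_zero, if_neg n.succ_ne_zero]
  | succ e ih =>
    rcases n with _ | n
    · simp [taylorCoeff]
    · have hslope : dslope (fun w : ℂ => c * w ^ (e + 1)) 0 = fun w => c * w ^ e :=
        dslope_eq_of_eq_add_mul (a := 0) (by fun_prop) fun w => by ring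
      simp [taylorCoeff, hslope, ih]

theorem exists_eq_pow_mul (hf : AnalyticAt ℂ f 0) {n : ℕ} (h : ∀ i < n, taylorCoeff f i = 0) :
    ∃ g : ℂ → ℂ, AnalyticAt ℂ g 0 ∧ ∀ w, f w = w ^ n * g w := by
  induction n generalizing f with
  | zero => exact ⟨f, hf, fun w => by simp⟩
  | succ n ih =>
    obtain ⟨g, hg, hfg⟩ := ih (analyticAt_dslope hf) fun i hi => h (i + 1) (by lia)
    have hf0 : f 0 = 0 := h 0 n.succ_pos
    exact ⟨g, hg, fun w => by rw [eq_add_mul_dslope f w, hf0, hfg]; ring⟩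

end TaylorCoefficients

/-! ### Constant and elementary gauge transformations -/

section ElementaryGauge

variable {r : ℕ} {m : Fin r → ℤ}

theorem twisted_mul_eq_one {p q : Mat r} (hp : ∀ i j, m i < m j → p i j = 0)
    (hq : ∀ i j, m i < m j → q i j = 0) (hpq : p * q = 1) (w : ℂ) :
    (Matrix.of fun i j => p i j * w ^ (m i - m j).toNat : Mat r) *
      (Matrix.of fun i j => q i j * w ^ (m i - m j).toNat) = 1 := by
  ext i j
  have hterm : ∀ c, p i c * w ^ (m i - m c).toNat * (q c j * w ^ (m c - m j).toNat) =
      p i c * q c j * w ^ (m i - m j).toNat := fun c => by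
    by_cases hi : m i < m c
    · simp [hp i c hi]
    by_cases hj : m c < m j
    · simp [hq c j hj]
    rw [show (m i - m j).toNat = (m i - m c).toNat + (m c - m j).toNat by lia, pow_add]
    ring
  simp only [Matrix.mul_apply, Matrix.of_apply, hterm, ← Finset.sum_mul]
  rw [← Matrix.mul_apply, hpq]
  rcases eq_or_ne i j with rfl | hij
  · simp
  · simp [Matrix.one_apply_ne hij]

/-- The automorphism of the bundle that is the constant `p` in the chart at infinity. -/
noncomputable def BundleAut.const (p : GL (Fin r) ℂ) (hp : IsParabolic m p) : BundleAut m where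
  g0 w :=
    { val := Matrix.of fun i j => (p : Mat r) i j * w ^ (m i - m j).toNat
      inv := Matrix.of fun i j => ((p⁻¹ : GL (Fin r) ℂ) : Mat r) i j * w ^ (m i - m j).toNat
      val_inv := twisted_mul_eq_one hp hp.inv p.mul_inv w
      inv_val := twisted_mul_eq_one hp.inv hp p.inv_mul w }
  g1 _ := p
  holo0 i j := by
    change Differentiable ℂ fun w => (p : Mat r) i j * w ^ (m i - m j).toNat
    fun_prop
  holo1 := isEntire_const _
  glue w hw := by
    ext i j
    rw [powMat_conj_apply m hw]
    change (p : Mat r) i j * w ^ (m i - m j).toNat = _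
    by_cases hij : m i < m j
    · simp [hp i j hij]
    · rw [mul_comm, ← zpow_natCast, Int.toNat_of_nonneg (by lia)]

theorem isEntire_transvectionGL {i j : Fin r} (hij : i ≠ j) {f : ℂ → ℂ}
    (hf : Differentiable ℂ f) : IsEntire fun w => (transvectionGL i j hij (f w) : Mat r) :=
  fun a b => by
    change Differentiable ℂ fun w => (1 + Matrix.single i j (f w)) a b
    simp only [Matrix.add_apply, Matrix.single_apply]
    split_ifs <;> fun_prop

/-- The elementary automorphism of the bundle given by `1 + c ζ ^ e E_ij` in the chart at
infinity. -/
noncomputable def BundleAut.elementary (i j : Fin r) (hij : i ≠ j) (c : ℂ) (e : ℕ)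
    (he : (e : ℤ) ≤ m i - m j) : BundleAut m where
  g0 w := transvectionGL i j hij (c * w ^ (m i - m j - e).toNat)
  g1 ζ := transvectionGL i j hij (c * ζ ^ e)
  holo0 := isEntire_transvectionGL hij (by fun_prop)
  holo1 := isEntire_transvectionGL hij (by fun_prop)
  glue w hw := by
    ext a b
    have hone : (1 : Mat r) a b = w ^ (m a - m b) * (1 : Mat r) a b := by
      rcases eq_or_ne a b with rfl | hab
      · simp
      · simp [Matrix.one_apply_ne hab]
    have hpow : w ^ (m i - m j - e).toNat = w ^ (m i - m j) * w⁻¹ ^ e := by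
      rw [← zpow_natCast, Int.toNat_of_nonneg (by lia), zpow_sub₀ hw, zpow_natCast, inv_pow,
        div_eq_mul_inv]
    rw [powMat_conj_apply m hw]
    change ((1 : Mat r) + Matrix.single i j (c * w ^ (m i - m j - e).toNat)) a b =
      w ^ (m a - m b) * ((1 : Mat r) + Matrix.single i j (c * w⁻¹ ^ e)) a b
    rw [Matrix.add_apply, Matrix.add_apply, mul_add, ← hone, Matrix.single_apply,
      Matrix.single_apply, hpow]
    split_ifs with h
    · rw [h.1, h.2]
      ring
    · rw [mul_zero]

/-- The form `P(ζ) dζ / ζ`, with `P` holomorphic at `0`, is the germ at infinity of the connection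
`A(z) dz`, in the trivialization over the chart at infinity. -/
def IsGermAtInfty (m : Fin r → ℤ) (A P : ℂ → Mat r) : Prop :=
  IsHolomorphicAtZero P ∧ ∀ᶠ ζ in 𝓝[≠] (0 : ℂ), connAtInfty m A ζ = ζ⁻¹ • P ζ

/-- The gauge transform by `g` of a germ `P(ζ) dζ / ζ` at infinity. -/
noncomputable def BundleAut.gaugeGerm (g : BundleAut m) (P : ℂ → Mat r) (ζ : ℂ) : Mat r :=
  Ad (g.g1 ζ) (P ζ) -
    ζ • (matDeriv (fun u => (g.g1 u : Mat r)) ζ * (((g.g1 ζ)⁻¹ : GL (Fin r) ℂ) : Mat r))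

theorem BundleAut.isGermAtInfty_act (g : BundleAut m) {A P : ℂ → Mat r}
    (hP : IsGermAtInfty m A P) : IsGermAtInfty m (g.act A) (g.gaugeGerm P) := by
  refine ⟨(g.isHolomorphicAtZero_Ad hP.1).sub g.isHolomorphicAtZero_matDeriv_mul_inv.smul, ?_⟩
  filter_upwards [hP.2, self_mem_nhdsWithin] with ζ hζ (hζ0 : ζ ≠ 0)
  rw [g.connAtInfty_act A hζ0, hζ, Ad_smul, gaugeGerm, smul_sub, smul_smul,
    inv_mul_cancel₀ hζ0, one_smul]

theorem BundleAut.gaugeGerm_const (p : GL (Fin r) ℂ) (hp : IsParabolic m p) (P : ℂ → Mat r)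
    (ζ : ℂ) : (BundleAut.const p hp).gaugeGerm P ζ = Ad p (P ζ) := by
  change Ad p (P ζ) - ζ • (matDeriv (fun _ => (p : Mat r)) ζ * _) = _
  rw [matDeriv_const, zero_mul, smul_zero, sub_zero]

theorem smul_matDeriv_transvection (i j : Fin r) (c : ℂ) (e : ℕ) (ζ : ℂ) :
    ζ • matDeriv (fun u => Matrix.transvection i j (c * u ^ e)) ζ =
      (e : ℂ) • Matrix.single i j (c * ζ ^ e) := by
  ext a b
  simp only [matDeriv, Matrix.transvection, Matrix.smul_apply, Matrix.of_apply, Matrix.add_apply,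
    Matrix.single_apply, smul_eq_mul, deriv_const_add]
  split_ifs
  · rcases e with _ | e
    · simp
    · simp only [deriv_const_mul_field', deriv_pow_field, add_tsub_cancel_right]
      ring
  · simp

theorem BundleAut.gaugeGerm_elementary {i j : Fin r} (hij : i ≠ j) (c : ℂ) {e : ℕ}
    (he : (e : ℤ) ≤ m i - m j) (P : ℂ → Mat r) (ζ : ℂ) :
    (elementary i j hij c e he).gaugeGerm P ζ =
      P ζ + (Matrix.single i j (c * ζ ^ e) * P ζ - P ζ * Matrix.single i j (c * ζ ^ e)) -
        Matrix.single i j (c * ζ ^ e) * P ζ * Matrix.single i j (c * ζ ^ e) -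
        (e : ℂ) • Matrix.single i j (c * ζ ^ e) := by
  have hneg : Matrix.transvection i j (-(c * ζ ^ e)) = 1 - Matrix.single i j (c * ζ ^ e) := by
    rw [Matrix.transvection, ← sub_neg_eq_add, ← Matrix.single_neg, neg_neg]
  change Matrix.transvection i j (c * ζ ^ e) * P ζ * Matrix.transvection i j (-(c * ζ ^ e)) -
    ζ • (matDeriv (fun u => Matrix.transvection i j (c * u ^ e)) ζ *
      Matrix.transvection i j (-(c * ζ ^ e))) = _
  rw [← smul_mul_assoc, smul_matDeriv_transvection, hneg, Matrix.transvection]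
  generalize hX : Matrix.single i j (c * ζ ^ e) = X
  have hsq : X * X = 0 := by
    rw [← hX, Matrix.single_mul_single_of_ne _ _ _ _ hij.symm]
  rw [smul_mul_assoc, mul_sub X, hsq, mul_one, sub_zero]
  noncomm_ring

end ElementaryGauge

/-! ### The weight filtration -/

section WeightFiltration

variable {r : ℕ} {σ : Equiv.Perm (Fin r)} {w w' : ℤ} {P Q : ℂ → Mat r}

/-- The weight of the monomial `ζ ^ n E_ij`, taken with respect to the ordering of the basis given
by `σ`. It is additive under multiplication, and the weights of the constant `E_ij` are less than
`r`, the weight of `ζ`, in absolute value. -/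
def monomialWeight (σ : Equiv.Perm (Fin r)) (i j : Fin r) (n : ℕ) : ℤ := n * r + (σ i : ℤ) - σ j

theorem monomialWeight_add (i l j : Fin r) (n n' : ℕ) :
    monomialWeight σ i j (n + n') = monomialWeight σ i l n + monomialWeight σ l j n' := by
  simp only [monomialWeight]
  push_cast
  ring

theorem eq_zero_and_le_of_monomialWeight_le_zero {i j : Fin r} {n : ℕ}
    (h : monomialWeight σ i j n ≤ 0) : n = 0 ∧ σ i ≤ σ j := by
  unfold monomialWeight at h
  obtain rfl : n = 0 := by
    by_contra hn
    nlinarith [show (1 : ℤ) ≤ n by lia, (σ j).isLt]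
  exact ⟨rfl, by simpa using h⟩

/-- The holomorphic germ `P` contains only monomials `ζ ^ n E_ij` of weight at least `w`. -/
structure HasWeightGE (σ : Equiv.Perm (Fin r)) (w : ℤ) (P : ℂ → Mat r) : Prop where
  isHolomorphicAtZero : IsHolomorphicAtZero P
  taylorCoeff_eq_zero : ∀ i j n, monomialWeight σ i j n < w → taylorCoeff (fun ζ => P ζ i j) n = 0

namespace HasWeightGE

theorem mono (hP : HasWeightGE σ w P) (h : w' ≤ w) : HasWeightGE σ w' P :=
  ⟨hP.1, fun i j n hn => hP.2 i j n (hn.trans_le h)⟩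

theorem add (hP : HasWeightGE σ w P) (hQ : HasWeightGE σ w Q) :
    HasWeightGE σ w fun ζ => P ζ + Q ζ :=
  ⟨hP.1.add hQ.1, fun i j n hn => by
    simp only [Matrix.add_apply]
    rw [taylorCoeff_add (hP.1 i j) (hQ.1 i j), hP.2 i j n hn, hQ.2 i j n hn, add_zero]⟩

theorem sub (hP : HasWeightGE σ w P) (hQ : HasWeightGE σ w Q) :
    HasWeightGE σ w fun ζ => P ζ - Q ζ :=
  ⟨hP.1.sub hQ.1, fun i j n hn => by
    simp only [Matrix.sub_apply]
    rw [taylorCoeff_sub (hP.1 i j) (hQ.1 i j), hP.2 i j n hn, hQ.2 i j n hn, sub_zero]⟩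

theorem mul (hP : HasWeightGE σ w P) (hQ : HasWeightGE σ w' Q) :
    HasWeightGE σ (w + w') fun ζ => P ζ * Q ζ := by
  refine ⟨hP.1.mul hQ.1, fun i j n hn => ?_⟩
  simp only [Matrix.mul_apply]
  rw [taylorCoeff_sum _ fun l => (hP.1 i l).fun_mul (hQ.1 l j)]
  refine Finset.sum_eq_zero fun l _ => ?_
  rw [taylorCoeff_mul (hP.1 i l) (hQ.1 l j)]
  refine Finset.sum_eq_zero fun p hp => ?_
  rw [← Finset.HasAntidiagonal.mem_antidiagonal.1 hp, monomialWeight_add i l j] at hn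
  rcases lt_or_ge (monomialWeight σ i l p.1) w with hlt | hge
  · rw [hP.2 i l p.1 hlt, zero_mul]
  · rw [hQ.2 l j p.2 (by linarith), mul_zero]

end HasWeightGE

theorem taylorCoeff_single_pow (i j : Fin r) (c : ℂ) (e : ℕ) (k l : Fin r) (n : ℕ) :
    taylorCoeff (fun ζ => Matrix.single i j (c * ζ ^ e) k l) n =
      if (i, j, e) = (k, l, n) then c else 0 := by
  simp only [Matrix.single_apply, Prod.mk.injEq]
  by_cases hkl : i = k ∧ j = l
  · simp only [hkl, true_and, if_true, taylorCoeff_const_mul_pow, eq_comm]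
  · rw [if_neg fun h => hkl ⟨h.1, h.2.1⟩]
    simp only [if_neg hkl, taylorCoeff_zero]

theorem hasWeightGE_single_pow (i j : Fin r) (c : ℂ) (e : ℕ) :
    HasWeightGE σ (monomialWeight σ i j e) fun ζ => Matrix.single i j (c * ζ ^ e) := by
  refine ⟨fun k l => ?_, fun k l n hn => ?_⟩
  · simp only [Matrix.single_apply]
    split_ifs <;> fun_prop
  · rw [taylorCoeff_single_pow, if_neg]
    rintro ⟨⟩
    exact hn.false

end WeightFiltration

/-! ### Existence of the normal form at infinity -/

section Normalization

variable {r : ℕ} {m : Fin r → ℤ} {σ : Equiv.Perm (Fin r)} {d : Fin r → ℂ} {N : ℂ → Mat r}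
  {A : ℂ → Mat r}

theorem gaugeGerm_elementary_diagonal_add {i j : Fin r} (hij : i ≠ j) (c : ℂ) {e : ℕ}
    (he : (e : ℤ) ≤ m i - m j) (ζ : ℂ) :
    (BundleAut.elementary i j hij c e he).gaugeGerm (fun u => Matrix.diagonal d + N u) ζ =
      Matrix.diagonal d + (N ζ - Matrix.single i j ((e + d i - d j) * c * ζ ^ e) +
        (Matrix.single i j (c * ζ ^ e) * N ζ - N ζ * Matrix.single i j (c * ζ ^ e) -
          Matrix.single i j (c * ζ ^ e) * N ζ * Matrix.single i j (c * ζ ^ e))) := by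
  rw [BundleAut.gaugeGerm_elementary]
  set X := Matrix.single i j (c * ζ ^ e) with hX
  have hmul_diag : X * Matrix.diagonal d = d j • X := by
    ext a b
    simp only [hX, Matrix.mul_diagonal, Matrix.smul_apply, Matrix.single_apply, smul_eq_mul]
    split_ifs with h
    · rw [h.2, mul_comm]
    · simp
  have hdiag_mul : Matrix.diagonal d * X = d i • X := by
    ext a b
    simp only [hX, Matrix.diagonal_mul, Matrix.smul_apply, Matrix.single_apply, smul_eq_mul]
    split_ifs with h
    · rw [h.1]
    · simp
  have hsq : X * X = 0 := by
    rw [hX, Matrix.single_mul_single_of_ne _ _ _ _ hij.symm]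
  have hlead : Matrix.single i j ((e + d i - d j) * c * ζ ^ e) = (e + d i - d j) • X := by
    rw [hX, Matrix.smul_single, smul_eq_mul, mul_assoc]
  rw [hlead, mul_add, add_mul (Matrix.diagonal d), add_mul (X * Matrix.diagonal d), hmul_diag,
    hdiag_mul, smul_mul_assoc, hsq, sub_smul, add_smul]
  module

theorem exists_gaugeGerm_taylorCoeff_eq_zero (hN : HasWeightGE σ 1 N) {i j : Fin r} (hij : i ≠ j)
    {e : ℕ} (he : (e : ℤ) ≤ m i - m j) (hne : (e : ℂ) + d i - d j ≠ 0)
    (hw : 1 ≤ monomialWeight σ i j e) :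
    ∃ (g : BundleAut m) (N' : ℂ → Mat r),
      (g.gaugeGerm fun ζ => Matrix.diagonal d + N ζ) = (fun ζ => Matrix.diagonal d + N' ζ) ∧
      HasWeightGE σ 1 N' ∧ taylorCoeff (fun ζ => N' ζ i j) e = 0 ∧
      ∀ k l n, monomialWeight σ k l n ≤ monomialWeight σ i j e →
        taylorCoeff (fun ζ => N ζ k l) n = 0 → taylorCoeff (fun ζ => N' ζ k l) n = 0 := by
  set c := taylorCoeff (fun ζ => N ζ i j) e
  set E : ℂ → Mat r := fun ζ => Matrix.single i j (c / (e + d i - d j) * ζ ^ e)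
  have hE : HasWeightGE σ (monomialWeight σ i j e) E := hasWeightGE_single_pow i j _ e
  have hrest : HasWeightGE σ (monomialWeight σ i j e + 1)
      fun ζ => E ζ * N ζ - N ζ * E ζ - E ζ * N ζ * E ζ :=
    ((hE.mul hN).sub ((hN.mul hE).mono (add_comm _ _).le)).sub
      (((hE.mul hN).mul hE).mono (by linarith))
  have hlead : HasWeightGE σ (monomialWeight σ i j e) fun ζ => Matrix.single i j (c * ζ ^ e) :=
    hasWeightGE_single_pow i j _ e
  set N' : ℂ → Mat r := fun ζ =>
    N ζ - Matrix.single i j (c * ζ ^ e) + (E ζ * N ζ - N ζ * E ζ - E ζ * N ζ * E ζ)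
  have hcoeff : ∀ k l n, monomialWeight σ k l n ≤ monomialWeight σ i j e →
      taylorCoeff (fun ζ => N' ζ k l) n =
        taylorCoeff (fun ζ => N ζ k l) n - if (i, j, e) = (k, l, n) then c else 0 := by
    intro k l n hkl
    have hadd := taylorCoeff_add ((hN.1 k l).fun_sub (hlead.1 k l)) (hrest.1 k l) n
    rw [hrest.2 k l n (by linarith), taylorCoeff_sub (hN.1 k l) (hlead.1 k l),
      taylorCoeff_single_pow, add_zero] at hadd
    exact hadd
  refine ⟨BundleAut.elementary i j hij (c / (e + d i - d j)) e he, N', funext fun ζ => ?_,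
    (hN.sub (hlead.mono hw)).add (hrest.mono (by linarith)), ?_, fun k l n hkl h0 => ?_⟩
  · rw [gaugeGerm_elementary_diagonal_add, mul_div_cancel₀ _ hne]
  · rw [hcoeff i j e le_rfl, if_pos rfl]
    exact sub_self c
  · rw [hcoeff k l n hkl, h0, zero_sub, neg_eq_zero]
    refine ite_eq_right_iff.2 fun h => ?_
    obtain ⟨rfl, rfl, rfl⟩ : i = k ∧ j = l ∧ e = n := by simpa using h
    exact h0

theorem exists_isGermAtInfty_act_forall_taylorCoeff_eq_zero
    (hd : ∀ i j, i ≠ j → ∀ n : ℕ, (n : ℂ) + d i - d j ≠ 0)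
    (hA : IsGermAtInfty m A fun ζ => Matrix.diagonal d + N ζ) (hN : HasWeightGE σ 1 N)
    (s : Finset (Fin r × Fin r × ℕ)) (hs : ∀ t ∈ s, (t.2.2 : ℤ) ≤ m t.1 - m t.2.1) :
    ∃ (g : BundleAut m) (N' : ℂ → Mat r),
      IsGermAtInfty m (g.act A) (fun ζ => Matrix.diagonal d + N' ζ) ∧ HasWeightGE σ 1 N' ∧
      ∀ t ∈ s, taylorCoeff (fun ζ => N' ζ t.1 t.2.1) t.2.2 = 0 := by
  induction s using Finset.induction_on_max_value
    (f := fun t : Fin r × Fin r × ℕ => monomialWeight σ t.1 t.2.1 t.2.2) with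
  | empty => exact ⟨1, N, by rwa [BundleAut.one_act], hN, by simp⟩
  | insert t s _ hmax ih =>
    obtain ⟨g, N₁, hg, hN₁, hzero⟩ := ih fun u hu => hs u (Finset.mem_insert_of_mem hu)
    obtain ⟨i, j, e⟩ := t
    have he : (e : ℤ) ≤ m i - m j := hs _ (Finset.mem_insert_self _ _)
    rcases le_or_gt (monomialWeight σ i j e) 0 with hw | hw
    · refine ⟨g, N₁, hg, hN₁, Finset.forall_mem_insert _ _ _ |>.2 ⟨?_, hzero⟩⟩
      exact hN₁.2 i j e (by linarith)
    · have hij : i ≠ j := by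
        rintro rfl
        obtain rfl : e = 0 := by lia
        simp [monomialWeight] at hw
      obtain ⟨g', N₂, hg', hN₂, hnew, hold⟩ :=
        exists_gaugeGerm_taylorCoeff_eq_zero hN₁ hij he (hd i j hij e) hw
      refine ⟨g' * g, N₂, ?_, hN₂, Finset.forall_mem_insert _ _ _ |>.2 ⟨hnew, fun u hu => ?_⟩⟩
      · rw [BundleAut.mul_act, ← hg']
        exact g'.isGermAtInfty_act hg
      · exact hold _ _ _ (hmax u hu) (hzero u hu)

theorem exists_zpow_mul_eq {f : ℂ → ℂ} (hf : AnalyticAt ℂ f 0) {n : ℤ}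
    (h : ∀ e : ℕ, (e : ℤ) ≤ n → taylorCoeff f e = 0) :
    ∃ g : ℂ → ℂ, AnalyticAt ℂ g 0 ∧ ∀ ζ, ζ ≠ 0 → ζ ^ (-n) * (ζ⁻¹ * f ζ) = g ζ := by
  obtain ⟨g, hg, hfg⟩ := exists_eq_pow_mul hf (n := (n + 1).toNat) fun e he => h e (by lia)
  refine ⟨fun ζ => ζ ^ ((n + 1).toNat - (n + 1)).toNat * g ζ,
    (analyticAt_id.pow _).mul hg, fun ζ hζ => ?_⟩
  change _ = ζ ^ ((n + 1).toNat - (n + 1)).toNat * g ζ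
  rw [hfg, ← mul_assoc, ← mul_assoc, ← zpow_neg_one, ← zpow_natCast,
    ← zpow_add₀ hζ, ← zpow_add₀ hζ, ← zpow_natCast]
  congr 2
  lia

theorem formAtInfty_eq (m : Fin r → ℤ) (A : ℂ → Mat r) {ζ : ℂ} (hζ : ζ ≠ 0) :
    formAtInfty A ζ = powMat (fun j => -m j) ζ * (connAtInfty m A ζ + ζ⁻¹ • splitMat m) *
      powMat m ζ := by
  have hcancel := powMat_neg_mul_powMat m hζ
  rw [connAtInfty, sub_add_cancel, Matrix.mul_assoc, Matrix.mul_assoc, hcancel, mul_one,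
    ← Matrix.mul_assoc, hcancel, one_mul]

theorem IsGermAtInfty.isNormalizedAtInfty {a : Fin r → ℝ}
    (hA : IsGermAtInfty m A fun ζ => Matrix.diagonal (fun i => (a (σ i) : ℂ)) + N ζ)
    (hN : IsHolomorphicAtZero N)
    (h : ∀ i j (e : ℕ), (e : ℤ) ≤ m i - m j → taylorCoeff (fun ζ => N ζ i j) e = 0) :
    IsNormalizedAtInfty m a σ A := by
  choose f hf hfN using fun i j => exists_zpow_mul_eq (hN i j) (h i j)
  refine ⟨fun ζ => Matrix.of fun i j => f i j ζ, hf, ?_⟩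
  filter_upwards [hA.2, self_mem_nhdsWithin] with ζ hζ (hζ0 : ζ ≠ 0)
  ext i j
  rw [formAtInfty_eq m A hζ0, powMat_neg_conj_apply m hζ0, hζ, normalResidue_eq, splitMat,
    ← smul_add, add_right_comm, Matrix.diagonal_add, Matrix.smul_apply, Matrix.add_apply,
    Matrix.add_apply, Matrix.smul_apply, Matrix.of_apply, ← hfN i j ζ hζ0, neg_sub, smul_eq_mul,
    smul_eq_mul, mul_add, mul_add]
  congr 1
  rcases eq_or_ne i j with rfl | hij
  · simp [add_comm]
  · simp [Matrix.diagonal_apply_ne _ hij]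

theorem Ad_diagonal_apply_of_isLowerTriangular {U : GL (Fin r) ℂ}
    (hU : (U : Mat r).IsLowerTriangular) (d : Fin r → ℂ) {i j : Fin r} (hij : i ≤ j) :
    Ad U (Matrix.diagonal d) i j = Matrix.diagonal d i j := by
  have hV : ((U⁻¹ : GL (Fin r) ℂ) : Mat r).IsLowerTriangular := blockTriangular_units_inv hU
  have hterm : ∀ l, (U : Mat r) i l * d l * ((U⁻¹ : GL (Fin r) ℂ) : Mat r) l j =
      d i * ((U : Mat r) i l * ((U⁻¹ : GL (Fin r) ℂ) : Mat r) l j) := fun l => by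
    rcases lt_trichotomy i l with hil | rfl | hli
    · simp [hU hil]
    · ring
    · simp [hV (hli.trans_le hij)]
  rw [Ad, Matrix.mul_apply]
  simp only [Matrix.mul_diagonal, hterm, ← Finset.mul_sum]
  rw [← Matrix.mul_apply, Units.mul_inv, Matrix.one_apply, Matrix.diagonal_apply, mul_ite, mul_one,
    mul_zero]

theorem exists_isGermAtInfty_act_diagonal_add {a : Fin r → ℝ} {f₁ : ℂ → Mat r} {R : Mat r}
    (hf₁ : IsHolomorphicAtZero f₁)
    (hA : ∀ᶠ ζ in 𝓝[≠] (0 : ℂ), connAtInfty m A ζ = ζ⁻¹ • R + f₁ ζ) {B : GL (Fin r) ℂ}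
    (hR : R = Ad B (weightMat a)) (hσ : InCell m σ (flagOfFrame B)) :
    ∃ (g : BundleAut m) (N : ℂ → Mat r), IsGermAtInfty m (g.act A)
      (fun ζ => Matrix.diagonal (fun i => (a (σ i) : ℂ)) + N ζ) ∧ HasWeightGE σ 1 N := by
  obtain ⟨p, hp, hF⟩ := hσ
  set D : Mat r := Matrix.diagonal fun i => (a (σ i) : ℂ)
  have hgerm : IsGermAtInfty m A fun ζ => R + ζ • f₁ ζ := by
    refine ⟨(isHolomorphicAtZero_const R).add hf₁.smul, ?_⟩
    filter_upwards [hA, self_mem_nhdsWithin] with ζ hζ (hζ0 : ζ ≠ 0)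
    rw [hζ, smul_add, smul_smul, inv_mul_cancel₀ hζ0, one_smul]
  have hact := (BundleAut.const p⁻¹ hp.inv).isGermAtInfty_act hgerm
  simp only [funext (BundleAut.gaugeGerm_const p⁻¹ hp.inv _)] at hact
  have hresidue : Ad p⁻¹ R = (Ad ((p * permGL σ)⁻¹ * B) (weightMat a)).submatrix σ σ := by
    rw [← Ad_permGL, ← Ad_mul, hR, ← Ad_mul]
    congr 1
    group
  refine ⟨BundleAut.const p⁻¹ hp.inv, fun ζ => Ad p⁻¹ (R + ζ • f₁ ζ) - D,
    by simpa only [add_sub_cancel] using hact, hact.1.sub (isHolomorphicAtZero_const D),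
    fun i j n hn => ?_⟩
  obtain ⟨rfl, hij⟩ := eq_zero_and_le_of_monomialWeight_le_zero (Int.lt_add_one_iff.1 hn)
  rw [taylorCoeff, zero_smul, add_zero, hresidue, Matrix.sub_apply, Matrix.submatrix_apply,
    weightMat, Ad_diagonal_apply_of_isLowerTriangular (isLowerTriangular_of_flagOfFrame_eq hF) _
      hij, sub_eq_zero]
  simp only [D, Matrix.diagonal_apply, σ.injective.eq_iff]

theorem exists_normalizing_gauge {a : Fin r → ℝ} (ha : IsNonresonant a) {f₁ : ℂ → Mat r}
    {R : Mat r} (hf₁ : IsHolomorphicAtZero f₁)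
    (hA : ∀ᶠ ζ in 𝓝[≠] (0 : ℂ), connAtInfty m A ζ = ζ⁻¹ • R + f₁ ζ) {B : GL (Fin r) ℂ}
    (hR : R = Ad B (weightMat a)) (hσ : InCell m σ (flagOfFrame B)) :
    ∃ g : BundleAut m, IsNormalizedAtInfty m a σ (g.act A) := by
  obtain ⟨g, N, hg, hN⟩ := exists_isGermAtInfty_act_diagonal_add hf₁ hA hR hσ
  obtain ⟨b, hb⟩ := exists_nat_forall_sub_le m
  have hd : ∀ i j, i ≠ j → ∀ n : ℕ, (n : ℂ) + a (σ i) - a (σ j) ≠ 0 := fun i j hij n => by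
    exact_mod_cast ha.int_add_sub_ne_zero (σ.injective.ne hij) n
  let s : Finset (Fin r × Fin r × ℕ) :=
    (Finset.univ ×ˢ Finset.univ ×ˢ Finset.range (b + 1)).filter fun t =>
      (t.2.2 : ℤ) ≤ m t.1 - m t.2.1
  obtain ⟨g', N', hg', hN', hzero⟩ := exists_isGermAtInfty_act_forall_taylorCoeff_eq_zero
    hd hg hN s fun t ht => (Finset.mem_filter.1 ht).2
  refine ⟨g' * g, ?_⟩
  rw [BundleAut.mul_act]
  refine hg'.isNormalizedAtInfty hN'.1 fun i j e he => hzero (i, j, e) ?_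
  have heb : e < b + 1 := by
    have := hb i j
    lia
  simpa [s, heb] using he

end Normalization

end RHGauge

theorem mainTheorem7_general {r k : ℕ} (m : Fin r → ℤ) (z : Fin k → ℂ)
    (α : Fin (k + 1) → Fin r → ℝ) (hα : RHGauge.IsNonresonant (α (Fin.last k)))
    (F : Fin (k + 1) → RHGauge.CompleteFlag r) (A : ℂ → RHGauge.Mat r)
    (hA : RHGauge.IsAdaptedConnection m z α F A) (x₀ : RHGauge.Punctured z) :
    (∃ σ : Equiv.Perm (Fin r), RHGauge.InCell m σ (F (Fin.last k))) ∧
    ∀ σ : Equiv.Perm (Fin r), RHGauge.InCell m σ (F (Fin.last k)) →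
      (∃ g : RHGauge.BundleAut m,
        RHGauge.IsNormalizedAtInfty m (α (Fin.last k)) σ (g.act A)) ∧
      (∀ g g' : RHGauge.BundleAut m,
        RHGauge.IsNormalizedAtInfty m (α (Fin.last k)) σ (g.act A) →
        RHGauge.IsNormalizedAtInfty m (α (Fin.last k)) σ (g'.act A) →
        ∃ d : Fin r → ℂ, (∀ j, d j ≠ 0) ∧
          ∀ w, (g'.g0 w : RHGauge.Mat r) = Matrix.diagonal d * (g.g0 w : RHGauge.Mat r)) ∧
      ∀ g : RHGauge.BundleAut m,
        RHGauge.IsNormalizedAtInfty m (α (Fin.last k)) σ (g.act A) →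
        RHGauge.IsAdaptedConnection m z α (g.actFlags z F) (g.act A) ∧
        (∃ R : Fin k → RHGauge.Mat r, RHGauge.IsFuchsianSystem z (g.act A) R ∧
          ∑ i, R i = -RHGauge.normalResidue m (α (Fin.last k)) σ) ∧
        ∃ ρ : FundamentalGroup (RHGauge.Punctured z) x₀ →* GL (Fin r) ℂ,
          RHGauge.IsMonodromyRep z A x₀ ρ ∧
          RHGauge.IsMonodromyRep z (g.act A) x₀
            ((MulAut.conj (g.g0 x₀)).toMonoidHom.comp ρ) := by
  have ⟨R, ⟨f₀, hf₀, h₀⟩, ⟨f₁, hf₁, h₁⟩, hframe⟩ := hA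
  obtain ⟨B, hR, hF⟩ := hframe (Fin.last k)
  refine ⟨hF ▸ RHGauge.exists_inCell m B, fun σ hσ => ⟨?_, ?_, fun g hg => ⟨?_, ?_, ?_⟩⟩⟩
  · exact RHGauge.exists_normalizing_gauge hα hf₁ h₁ hR (hF ▸ hσ)
  · exact fun g g' hg hg' => g.exists_diagonal_mul_eq g' hα hg hg'
  · exact g.isAdaptedConnection_act hA
  · obtain ⟨f, hf, hact⟩ := g.exists_act_eq_sum_add hf₀ h₀
    obtain ⟨f', hf', hact'⟩ := hg
    exact ⟨_, RHGauge.isFuchsianSystem_of_formAtInfty hf hact hf' hact'⟩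
  · obtain ⟨ρ, hρ⟩ := RHGauge.exists_isMonodromyRep hA.analyticAt x₀
    exact ⟨ρ, hρ, g.isMonodromyRep_act hρ⟩

theorem mainTheorem7 {r k : ℕ} (m : Fin r → ℤ) (hm : Monotone m)
    (z : Fin k → ℂ) (hz : Function.Injective z)
    (α : Fin (k + 1) → Fin r → ℝ) (hα : ∀ i, StrictMono (α i))
    (hα01 : ∀ i j, 0 ≤ α i j ∧ α i j < 1)
    (F : Fin (k + 1) → RHGauge.CompleteFlag r) (A : ℂ → RHGauge.Mat r)
    (hA : RHGauge.IsAdaptedConnection m z α F A) (x₀ : RHGauge.Punctured z) :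
    (∃ σ : Equiv.Perm (Fin r), RHGauge.InCell m σ (F (Fin.last k))) ∧
    ∀ σ : Equiv.Perm (Fin r), RHGauge.InCell m σ (F (Fin.last k)) →
      (∃ g : RHGauge.BundleAut m,
        RHGauge.IsNormalizedAtInfty m (α (Fin.last k)) σ (g.act A)) ∧
      (∀ g g' : RHGauge.BundleAut m,
        RHGauge.IsNormalizedAtInfty m (α (Fin.last k)) σ (g.act A) →
        RHGauge.IsNormalizedAtInfty m (α (Fin.last k)) σ (g'.act A) →
        ∃ d : Fin r → ℂ, (∀ j, d j ≠ 0) ∧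
          ∀ w, (g'.g0 w : RHGauge.Mat r) = Matrix.diagonal d * (g.g0 w : RHGauge.Mat r)) ∧
      ∀ g : RHGauge.BundleAut m,
        RHGauge.IsNormalizedAtInfty m (α (Fin.last k)) σ (g.act A) →
        RHGauge.IsAdaptedConnection m z α (g.actFlags z F) (g.act A) ∧
        (∃ R : Fin k → RHGauge.Mat r, RHGauge.IsFuchsianSystem z (g.act A) R ∧
          ∑ i, R i = -RHGauge.normalResidue m (α (Fin.last k)) σ) ∧
        ∃ ρ : FundamentalGroup (RHGauge.Punctured z) x₀ →* GL (Fin r) ℂ,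
          RHGauge.IsMonodromyRep z A x₀ ρ ∧
          RHGauge.IsMonodromyRep z (g.act A) x₀
            ((MulAut.conj (g.g0 x₀)).toMonoidHom.comp ρ) :=
  mainTheorem7_general m z α
    (RHGauge.isNonresonant_of_injective (hα _).injective (hα01 _)) F A hA x₀
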